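/- Let $p_0,\dots,p_3\in S^2\subset\mathbb R^3$ be the vertices of a regular tetrahedron centred at $0$, let $R_j=\{tp_j:t\ge 0\}$ and $\mathcal R=R_0\cup\dots\cup R_3$, and let $\Gamma\subset O(3)$ be the symmetry group of the tetrahedron, generated by the reflections $\rho_e$ across the planes through $0$ containing an edge $e$ of the associated spherical tetrahedron. Let $\mathcal I\to\mathbb R^3\setminus\mathcal R$ be the flat metric real line bundle with monodromy $-1$ around each ray $R_j\setminus\{0\}$; each $\rho_e$ lifts to $\mathcal I$ uniquely as the flat isometry that is the identity on the fibres over the relative interior of $e$. A section of $\mathcal I$ (a two-valued function $\pm u$) is called $\Gamma$-equivariant if each of these lifted reflections multiplies it by $-1$. Let $(\phi_\ell)_{\ell\ge1}$ be an $L^2(S^2)$-orthonormal sequence of bounded $\Gamma$-equivariant $\mathbb Z_2$-eigenfunctions, that is, bounded $\Gamma$-equivariant $C^2$ sections of $\mathcal I$ over $S^2\setminus\{p_0,\dots,p_3\}$ with $\Delta_{S^2}\phi_\ell+\lambda_\ell\phi_\ell=0$, put $\gamma_\ell^+=-\frac12+\sqrt{\frac14+\lambda_\ell}$, and let $(a_\ell)$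 be square-summable. Let $u$ be a $\Gamma$-equivariant $\mathbb Z_2$-harmonic function on the open unit ball $B^3$ (a harmonic section of $\mathcal I$ over $B^3\setminus\mathcal R$) of the form $$u(r,y)=\sum_{\ell} a_\ell\, r^{\gamma_\ell^+}\phi_\ell(y),\qquad 0<r<1,\ y\in S^2\setminus\{p_0,\dots,p_3\}.$$ Then: (i) for every $r_0\in(0,1)$ there is a constant $C$ with $|u(x)|\le C\,\mathrm{dist}(x,\mathcal R)^{3/2}$ for all $x\notin\mathcal R$ with $|x|\le r_0$; (ii) there are $\varepsilon>0$, $C$ and $\delta>0$ with $|u(x)|\le C|x|^{3/2+\varepsilon}$ for all $x\notin\mathcal R$ with $|x|<\delta$. -/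

import Mathlib

noncomputable section

namespace TetraZ2

/-- Euclidean three-space. -/
abbrev E : Type := EuclideanSpace ℝ (Fin 3)

/-- The vertices `p₀, …, p₃ ∈ S²` of a regular tetrahedron centred at the origin. -/
def vertex (j : Fin 4) : E :=
  (√3)⁻¹ • (![!₂[1, 1, 1], !₂[1, -1, -1], !₂[-1, 1, -1], !₂[-1, -1, 1]] : Fin 4 → E) j

/-- The ray `R_j = {t p_j : t ≥ 0}`. -/
def ray (j : Fin 4) : Set E := {x | ∃ t : ℝ, 0 ≤ t ∧ x = t • vertex j}

/-- The branching set `R = R₀ ∪ R₁ ∪ R₂ ∪ R₃`. -/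
def branchSet : Set E := ⋃ j, ray j

/-- The wall over the edge `p_i p_j` of the spherical tetrahedron: the closed planar sector spanned
by `p_i` and `p_j`. -/
def wall (i j : Fin 4) : Set E :=
  {x | ∃ s t : ℝ, 0 ≤ s ∧ 0 ≤ t ∧ x = s • vertex i + t • vertex j}

/-- The chamber `C_k`: the open cone over the `k`-th spherical triangle `T_k`, the one whose vertices
are the `p_j` with `j ≠ k`.  The faces `T_a` and `T_b` share the edge joining the other two
vertices. -/
def chamber (k : Fin 4) : Set E :=
  {x | ∃ t : Fin 4 → ℝ, t k = 0 ∧ (∀ j, j ≠ k → 0 < t j) ∧ x = ∑ j, t j • vertex j}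

/-! ### The flat line bundle

The flat metric real line bundle `𝓘` over `ℝ³ ∖ R` with monodromy `-1` around each ray is built from
transition functions.  Let `e_k` be a unit flat frame over the chamber `C_k`, and glue the four
chambers so that `e_a` continues as `-e_b` across the wall between `C_a` and `C_b`.  Three walls meet
along each ray, so the monodromy around it is `(-1)³ = -1`.  The frame `e_a` extends to the set
`chart a` below (it is `-e_b` on every other chamber `C_b`); these four open sets cover `ℝ³ ∖ R`. -/

/-- The domain of the `a`-th flat frame: the complement of the three walls that contain `p_a`. -/
def chart (a : Fin 4) : Set E := (⋃ b, wall a b)ᶜ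

open Classical in
/-- The transition function between the `a`-th and `b`-th flat frames over `chart a ∩ chart b`,
for `a ≠ b`: it is `+1` over the two chambers `C_c` with `c ≠ a, b`, and `-1` over
`C_a`, `C_b` and the interior of the wall between these two. -/
def transition (a b : Fin 4) (x : E) : ℝ :=
  if ∃ c, c ≠ a ∧ c ≠ b ∧ x ∈ chamber c then 1 else -1

/-- `u` is a section of `𝓘` over `U ∖ R` (a two-valued function with values `±u`); `u a x` is its
coordinate at `x ∈ chart a` in the `a`-th frame.  Values of `u a` off `U ∩ chart a` play no role. -/
def IsSection (U : Set E) (u : Fin 4 → E → ℝ) : Prop :=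
  ∀ a b, a ≠ b → ∀ x ∈ U ∩ (chart a ∩ chart b), u b x = transition a b x * u a x

/-- The plane of the edge shared by the faces `T_a` and `T_b`, spanned by the two other vertices. -/
def mirrorPlane (a b : Fin 4) : Submodule ℝ E :=
  Submodule.span ℝ {v | ∃ c, c ≠ a ∧ c ≠ b ∧ v = vertex c}

/-- The orthogonal reflection across the edge shared by `T_a` and `T_b`.  It interchanges `p_a` and
`p_b` and fixes the two other vertices; these six reflections generate `Γ`. -/
def mirror (a b : Fin 4) (x : E) : E := (mirrorPlane a b).reflection x

/-- The action on sections of the lift of `mirror a b` to `𝓘` which is the identity on the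
fibres over the mirror edge, the one shared by `T_a` and `T_b`.  It sends the frame `e_c` to
`-e_{τ c}`, where `τ` is the transposition of `a` and `b`.  (Over the mirror edge the `a`-th
coordinate of the image of `u` is `-u b = u a`.) -/
def reflectSection (a b : Fin 4) (u : Fin 4 → E → ℝ) : Fin 4 → E → ℝ :=
  fun c x => -u (Equiv.swap a b c) (mirror a b x)

/-- `Γ`-equivariance: `u` is multiplied by `-1` by each of the reflections in `Γ`. -/
def IsEquivariant (U : Set E) (u : Fin 4 → E → ℝ) : Prop :=
  ∀ a b, a ≠ b → ∀ c, ∀ x ∈ U ∩ chart c, reflectSection a b u c x = -u c x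

/-- The unit sphere `S²`. -/
abbrev S2 : Set E := Metric.sphere (0 : E) 1

/-- The extension of a function on `S²` that is constant along rays. -/
def radialExt (f : E → ℝ) : E → ℝ := fun x => f (‖x‖⁻¹ • x)

/-- The Laplace–Beltrami operator of `S²` at `y ∈ S²`: the Euclidean Laplacian of the extension
that is constant along rays. -/
def sphereLaplacian (f : E → ℝ) (y : E) : ℝ := Laplacian.laplacian (radialExt f) y

/-- A `Γ`-equivariant `ℤ₂`-eigenfunction on `S²`: a bounded `Γ`-equivariant section `φ` of `𝓘` over
`S² ∖ {p₀, …, p₃}`, twice continuously differentiable, with `Δ_{S²} φ + lam φ = 0`. -/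
structure IsEigenfunction (lam : ℝ) (φ : Fin 4 → E → ℝ) : Prop where
  isSection : IsSection S2 φ
  equivariant : IsEquivariant S2 φ
  contDiffAt : ∀ a, ∀ y ∈ S2 ∩ chart a, ContDiffAt ℝ 2 (radialExt (φ a)) y
  eigen : ∀ a, ∀ y ∈ S2 ∩ chart a, sphereLaplacian (φ a) y + lam * φ a y = 0
  bounded : ∃ M : ℝ, ∀ a, ∀ y ∈ S2 ∩ chart a, |φ a y| ≤ M

/-- The `L²` inner product of two sections of `𝓘` over `S²`.  The product of two sections is a
function; it is computed in the frame number `0`, whose domain has full measure in `S²`. -/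
def sphereInner (φ ψ : Fin 4 → E → ℝ) : ℝ :=
  ∫ y : S2, φ 0 y * ψ 0 y ∂(MeasureTheory.volume : MeasureTheory.Measure E).toSphere

/-- The exponent `γ⁺`, the larger root of `γ (γ + 1) = lam`. -/
def gammaPlus (lam : ℝ) : ℝ := -(1 / 2) + √(1 / 4 + lam)

/-- The open unit ball `B³`. -/
abbrev B3 : Set E := Metric.ball (0 : E) 1

/-- `u` is a `ℤ₂`-harmonic function on `B³` that branches along `R`: a section of `𝓘` over `B³ ∖ R`
that is harmonic (in flat frames). -/
def IsZ2Harmonic (u : Fin 4 → E → ℝ) : Prop :=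
  IsSection B3 u ∧ ∀ a, InnerProductSpace.HarmonicOnNhd (u a) (B3 ∩ chart a)

/-- `u = 𝓟(φ) = ∑ a_ℓ r^{γ_ℓ⁺} φ_ℓ` on `B³`, with boundary values `φ = ∑ a_ℓ φ_ℓ` in `L²`,
where the `φ_ℓ` are `L²`-orthonormal `Γ`-equivariant `ℤ₂`-eigenfunctions on `S²`. -/
def IsPoissonExtension (u : Fin 4 → E → ℝ) : Prop :=
  ∃ (lam : ℕ → ℝ) (φ : ℕ → Fin 4 → E → ℝ) (coeff : ℕ → ℝ),
    (∀ l, IsEigenfunction (lam l) (φ l)) ∧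
    (∀ k l, sphereInner (φ k) (φ l) = if k = l then 1 else 0) ∧
    Summable (fun l => coeff l ^ 2) ∧
    ∀ a, ∀ y ∈ S2 ∩ chart a, ∀ r ∈ Set.Ioo (0 : ℝ) 1,
      HasSum (fun l => coeff l * r ^ gammaPlus (lam l) * φ l a y) (u a (r • y))

end TetraZ2

end

/-!
The reflection across the plane of an edge fixes the fibres of the bundle over that edge, so an
equivariant section vanishes on the interiors of the walls (`IsEquivariant.eq_zero`).  Hence the
four chambers decouple: on each `C_k` the section is an ordinary function with zero boundary values
on the three faces of a cone, and the only difficulty sits at the rays, where no boundary condition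
is imposed and only boundedness is known.

Near the ray over `p_j` the chamber `C_k` is a lune of opening `2π/3`.  In the complex coordinate
`ζ = luneCoord` of the plane orthogonal to `p_j`, with real axis bisecting the lune, the function
`Re ζ ^ (3/2)` vanishes on its two faces, which is where the exponent `3/2` comes from.  The
harmonic function `Re ζ ^ (-3/4)` tends to infinity at the ray and is nonnegative, so with an
arbitrarily small multiple of it the maximum principle ignores the rays (`le_of_superharmonic`).
Let `q` be a point of the line through `p_j`, and let `A` and `B` be the linear forms that vanish on
the two faces.  Comparison with the harmonic function `|x - q|² + (9/2) Re ζ ^ (3/2) - (9/4) A B`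
gives the decay `|ζ| ^ (3/2)` of bounded solutions (`le_luneCoord_rpow`), and inside the chamber the
distance to the branching set is at least `|ζ|` for one of its three rays.

The exponents of the eigenfunctions exceed `3/2`.  The functions
`Re ζ ^ (7/5) r ^ (1/8) (13/5 - r / (r + z))`, with `z` the height along the ray, are superharmonic
on `C_k` and homogeneous of degree `61/40`; the sum of the three of them is bounded below by a
multiple of `r ^ (61/40)`.  A solution that grows at a slower rate is therefore zero
(`nonpos_of_le_norm_rpow`), and `r ^ γ φ` is a solution that is homogeneous of degree `γ`.  So every
exponent in the series is at least `61/40 = 3/2 + 1/40` (`le_gammaPlus_of_orthonormal`).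

It remains to bound the sum of the series, given only square-summable coefficients.  By
orthonormality the `L²` norm of a finite sum over the unit ball is at most the `ℓ²` norm of its
coefficients.  A finite sum tends to zero at the boundary of `C_k`, so a convex cutoff of it extends
by zero to a subharmonic `C²` function on the whole space, and the mean value inequality turns the
`L²` bound into a pointwise one (`exists_sq_partialSum_le`).  Scaling `x` and absorbing the powers
of the scale into the coefficients yields the decay of order `61/40` at the origin; boundedness and the
estimate at the rays yield the decay of order `3/2` along the branching set.
-/

noncomputable section

namespace TetraZ2

open Laplacian InnerProductSpace Filter Topology Set

/-! ### Gradients and Laplacians of composite functions -/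

section GradLap

variable {V : Type*} [NormedAddCommGroup V] [InnerProductSpace ℝ V] [FiniteDimensional ℝ V]

/-- The function `f` is `C²` at `x`, with gradient `G` and Laplacian `l` there. -/
structure HasGradLap (f : V → ℝ) (x G : V) (l : ℝ) : Prop where
  contDiffAt : ContDiffAt ℝ 2 f x
  hasFDerivAt : HasFDerivAt f (innerSL ℝ G) x
  laplacian_eq : Δ f x = l

theorem laplacian_eq_sum_fderiv {ι : Type*} [Fintype ι] (b : OrthonormalBasis ι ℝ V) (f : V → ℝ)
    (x : V) : Δ f x = ∑ i, fderiv ℝ (fderiv ℝ f) x (b i) (b i) := by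
  rw [laplacian_eq_iteratedFDeriv_orthonormalBasis f b]
  simp [iteratedFDeriv_two_apply]

theorem differentiableAt_fderiv_of_contDiffAt_two {W : Type*} [NormedAddCommGroup W]
    [NormedSpace ℝ W] {f : W → ℝ} {x : W}
    (hf : ContDiffAt ℝ 2 f x) : DifferentiableAt ℝ (fderiv ℝ f) x :=
  (hf.fderiv_right (m := 1) (by norm_num)).differentiableAt (by norm_num)

theorem eventually_differentiableAt_of_contDiffAt_two {W : Type*} [NormedAddCommGroup W]
    [NormedSpace ℝ W] {f : W → ℝ} {x : W} (hf : ContDiffAt ℝ 2 f x) :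
    ∀ᶠ y in 𝓝 x, DifferentiableAt ℝ f y := by
  filter_upwards [hf.eventually (by simp)] with y hy
  exact hy.differentiableAt (by norm_num)

theorem hasGradLap_of_contDiffAt {f : V → ℝ} {x : V} (hf : ContDiffAt ℝ 2 f x) :
    HasGradLap f x (gradient f x) (Δ f x) := by
  refine ⟨hf, ?_, rfl⟩
  exact (hf.differentiableAt (by norm_num)).hasGradientAt.hasFDerivAt

theorem HasGradLap.congr {f g : V → ℝ} {x G : V} {l : ℝ} (hf : HasGradLap f x G l)
    (h : f =ᶠ[𝓝 x] g) : HasGradLap g x G l where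
  contDiffAt := hf.contDiffAt.congr_of_eventuallyEq h.symm
  hasFDerivAt := hf.hasFDerivAt.congr_of_eventuallyEq h.symm
  laplacian_eq := by rw [← laplacian_congr_nhds h |>.eq_of_nhds]; exact hf.laplacian_eq

theorem HasGradLap.congr_val {f : V → ℝ} {x G G' : V} {l l' : ℝ} (hf : HasGradLap f x G l)
    (hG : G = G') (hl : l = l') : HasGradLap f x G' l' := by
  subst hG hl; exact hf

theorem hasGradLap_const (c : ℝ) (x : V) : HasGradLap (fun _ => c) x 0 0 where
  contDiffAt := contDiffAt_const
  hasFDerivAt := by simpa using hasFDerivAt_const c x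
  laplacian_eq := by
    rw [laplacian_const]; rfl

theorem HasGradLap.add {f g : V → ℝ} {x G H : V} {l m : ℝ} (hf : HasGradLap f x G l)
    (hg : HasGradLap g x H m) : HasGradLap (fun y => f y + g y) x (G + H) (l + m) where
  contDiffAt := hf.contDiffAt.add hg.contDiffAt
  hasFDerivAt := (hf.hasFDerivAt.add hg.hasFDerivAt).congr_fderiv (by simp)
  laplacian_eq := by
    have := hf.contDiffAt.laplacian_add hg.contDiffAt
    rw [hf.laplacian_eq, hg.laplacian_eq] at this
    exact this

/-- The product rule `Δ(f g) = f Δg + g Δf + 2 ∇f · ∇g`. -/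
theorem HasGradLap.mul {f g : V → ℝ} {x G H : V} {l m : ℝ} (hf : HasGradLap f x G l)
    (hg : HasGradLap g x H m) :
    HasGradLap (fun y => f y * g y) x (f x • H + g x • G)
      (f x * m + g x * l + 2 * inner ℝ G H) where
  contDiffAt := hf.contDiffAt.mul hg.contDiffAt
  hasFDerivAt := (hf.hasFDerivAt.mul hg.hasFDerivAt).congr_fderiv (by simp)
  laplacian_eq := by
    have e1 : fderiv ℝ (fun y => f y * g y) =ᶠ[𝓝 x]
        fun y => f y • fderiv ℝ g y + g y • fderiv ℝ f y := by
      filter_upwards [eventually_differentiableAt_of_contDiffAt_two hf.contDiffAt,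
        eventually_differentiableAt_of_contDiffAt_two hg.contDiffAt] with y h1 h2
      exact fderiv_fun_mul h1 h2
    have h2 := (hf.hasFDerivAt.smul
      (differentiableAt_fderiv_of_contDiffAt_two hg.contDiffAt).hasFDerivAt).add
      (hg.hasFDerivAt.smul (differentiableAt_fderiv_of_contDiffAt_two hf.contDiffAt).hasFDerivAt)
    have h3 := (h2.congr_of_eventuallyEq e1).fderiv
    have b := stdOrthonormalBasis ℝ V
    rw [laplacian_eq_sum_fderiv b, h3, ← hf.laplacian_eq, ← hg.laplacian_eq,
      laplacian_eq_sum_fderiv b, laplacian_eq_sum_fderiv b, hf.hasFDerivAt.fderiv,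
      hg.hasFDerivAt.fderiv, ← b.sum_inner_mul_inner G H, Finset.mul_sum, Finset.mul_sum,
      Finset.mul_sum, ← Finset.sum_add_distrib, ← Finset.sum_add_distrib]
    refine Finset.sum_congr rfl fun i _ => ?_
    simp [real_inner_comm H]
    ring

/-- The chain rule `Δ(φ ∘ f) = φ'' |∇f|² + φ' Δf`. -/
theorem HasGradLap.comp {f : V → ℝ} {x G : V} {l : ℝ} (hf : HasGradLap f x G l)
    {φ φ' : ℝ → ℝ} {φ'' : ℝ} (hc : ContDiffAt ℝ 2 φ (f x))
    (h1 : ∀ᶠ t in 𝓝 (f x), HasDerivAt φ (φ' t) t) (h2 : HasDerivAt φ' φ'' (f x)) :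
    HasGradLap (fun y => φ (f y)) x (φ' (f x) • G) (φ'' * ‖G‖ ^ 2 + φ' (f x) * l) where
  contDiffAt := hc.comp x hf.contDiffAt
  hasFDerivAt := (h1.self_of_nhds.comp_hasFDerivAt x hf.hasFDerivAt).congr_fderiv (by simp)
  laplacian_eq := by
    have e1 : fderiv ℝ (fun y => φ (f y)) =ᶠ[𝓝 x] fun y => φ' (f y) • fderiv ℝ f y := by
      filter_upwards [eventually_differentiableAt_of_contDiffAt_two hf.contDiffAt,
        hf.contDiffAt.continuousAt.eventually h1] with y hy1 hy2
      exact (hy2.comp_hasFDerivAt y hy1.hasFDerivAt).fderiv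
    have h3 := (h2.comp_hasFDerivAt x hf.hasFDerivAt).smul
      (differentiableAt_fderiv_of_contDiffAt_two hf.contDiffAt).hasFDerivAt
    have h4 := (h3.congr_of_eventuallyEq e1).fderiv
    have b := stdOrthonormalBasis ℝ V
    rw [laplacian_eq_sum_fderiv b, h4, ← hf.laplacian_eq,
      laplacian_eq_sum_fderiv b, hf.hasFDerivAt.fderiv, ← real_inner_self_eq_norm_sq,
      ← b.sum_inner_mul_inner G G, Finset.mul_sum, Finset.mul_sum, ← Finset.sum_add_distrib]
    refine Finset.sum_congr rfl fun i _ => ?_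
    simp [real_inner_comm G]
    ring

theorem HasGradLap.const_mul {f : V → ℝ} {x G : V} {l : ℝ} (c : ℝ) (hf : HasGradLap f x G l) :
    HasGradLap (fun y => c * f y) x (c • G) (c * l) :=
  ((hasGradLap_const c x).mul hf).congr_val (by simp) (by simp)

theorem HasGradLap.sub {f g : V → ℝ} {x G H : V} {l m : ℝ} (hf : HasGradLap f x G l)
    (hg : HasGradLap g x H m) : HasGradLap (fun y => f y - g y) x (G - H) (l - m) :=
  ((hf.add (hg.const_mul (-1))).congr (by simp [sub_eq_add_neg])).congr_val
    (by simp [sub_eq_add_neg]) (by ring)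

theorem HasGradLap.sum {ι : Type*} (s : Finset ι) {f : ι → V → ℝ} {x : V} {G : ι → V} {l : ι → ℝ}
    (hf : ∀ i ∈ s, HasGradLap (f i) x (G i) (l i)) :
    HasGradLap (fun y => ∑ i ∈ s, f i y) x (∑ i ∈ s, G i) (∑ i ∈ s, l i) := by
  classical
  induction s using Finset.induction_on with
  | empty => simpa using hasGradLap_const 0 x
  | insert a s ha ih =>
    simp only [Finset.sum_insert ha]
    exact (hf a (by simp)).add (ih fun i hi => hf i (by simp [hi]))

/-- The Laplacian of a composition with a linear map, on the level of second derivatives. -/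
theorem fderiv_fderiv_comp_clm {U W : Type*} [NormedAddCommGroup U] [NormedSpace ℝ U]
    [NormedAddCommGroup W] [NormedSpace ℝ W]
    {h : W → ℝ} (L : U →L[ℝ] W) {x : U} (hh : ContDiffAt ℝ 2 h (L x)) (v : U) :
    fderiv ℝ (fderiv ℝ (fun y => h (L y))) x v v = fderiv ℝ (fderiv ℝ h) (L x) (L v) (L v) := by
  have e1 : fderiv ℝ (fun y => h (L y)) =ᶠ[𝓝 x] fun y => (fderiv ℝ h (L y)).comp L := by
    filter_upwards [L.continuous.continuousAt.eventually
      (eventually_differentiableAt_of_contDiffAt_two hh)] with y hy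
    exact (hy.hasFDerivAt.comp y L.hasFDerivAt).fderiv
  have h2 := ((differentiableAt_fderiv_of_contDiffAt_two hh).hasFDerivAt.comp x
    L.hasFDerivAt).clm_comp (hasFDerivAt_const L x)
  rw [(h2.congr_of_eventuallyEq e1).fderiv]
  simp

theorem laplacian_comp_smul {f : V → ℝ} (c : ℝ) {x : V} (hf : ContDiffAt ℝ 2 f (c • x)) :
    Δ (fun y => f (c • y)) x = c ^ 2 * Δ f (c • x) := by
  have b := stdOrthonormalBasis ℝ V
  rw [laplacian_eq_sum_fderiv b, laplacian_eq_sum_fderiv b, Finset.mul_sum]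
  refine Finset.sum_congr rfl fun i _ => ?_
  have := fderiv_fderiv_comp_clm (c • ContinuousLinearMap.id ℝ V) (x := x) (h := f)
    (by simpa using hf) (b i)
  simp only [FunLike.coe_smul, ContinuousLinearMap.coe_id', Pi.smul_apply, id_eq,
    map_smul, smul_eq_mul] at this
  rw [this]
  ring

theorem hasGradLap_inner (p x : V) : HasGradLap (fun y => inner ℝ p y) x p 0 where
  contDiffAt := contDiffAt_const.inner ℝ contDiffAt_id
  hasFDerivAt := (innerSL ℝ p).hasFDerivAt
  laplacian_eq := by
    have b := stdOrthonormalBasis ℝ V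
    rw [laplacian_eq_sum_fderiv b]
    have : fderiv ℝ (fun y => inner ℝ p y) = fun _ => innerSL ℝ p := by
      ext1 y
      exact (innerSL ℝ p).hasFDerivAt.fderiv
    rw [this]
    simp

theorem hasGradLap_norm_sq (x : V) :
    HasGradLap (fun y => ‖y‖ ^ 2) x ((2 : ℝ) • x) (2 * Module.finrank ℝ V) where
  contDiffAt := contDiffAt_id.norm_sq ℝ
  hasFDerivAt := (hasStrictFDerivAt_norm_sq x).hasFDerivAt.congr_fderiv (by
    ext y; simp [two_smul])
  laplacian_eq := by
    have b := stdOrthonormalBasis ℝ V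
    rw [laplacian_eq_sum_fderiv b]
    have : fderiv ℝ (fun y : V => ‖y‖ ^ 2) = fun y => (2 • innerSL ℝ : V →L[ℝ] V →L[ℝ] ℝ) y := by
      ext1 y
      exact (hasStrictFDerivAt_norm_sq y).hasFDerivAt.fderiv
    rw [this, ContinuousLinearMap.fderiv]
    have hb : ∀ i, (innerSL ℝ) (b i) (b i) = (1 : ℝ) := fun i => by simp
    simp [hb, mul_comm]

theorem hasGradLap_norm {x : V} (hx : x ≠ 0) :
    HasGradLap (fun y => ‖y‖) x (‖x‖⁻¹ • x) ((Module.finrank ℝ V - 1) / ‖x‖) := by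
  have hp : 0 < ‖x‖ := norm_pos_iff.2 hx
  have hp2 : ‖x‖ ^ 2 ≠ 0 := by positivity
  have hev : ∀ᶠ t in 𝓝 (‖x‖ ^ 2), t ≠ 0 := isOpen_ne.mem_nhds hp2
  have hs : HasDerivAt (fun t => 1 / (2 * √t)) (-(1 / (4 * ‖x‖ ^ 3))) (‖x‖ ^ 2) := by
    have h1 := (Real.hasDerivAt_sqrt hp2).const_mul 2
    have h2 := h1.inv (by rw [Real.sqrt_sq hp.le]; positivity)
    refine (h2.congr_of_eventuallyEq (Eventually.of_forall fun t => by simp)).congr_deriv ?_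
    rw [Real.sqrt_sq hp.le]
    field_simp
    norm_num
  have h := (hasGradLap_norm_sq x).comp (φ := fun t => √t) (φ' := fun t => 1 / (2 * √t))
    (Real.contDiffAt_sqrt hp2) (hev.mono fun t ht => Real.hasDerivAt_sqrt ht) hs
  refine (h.congr (by simp [Real.sqrt_sq])).congr_val ?_ ?_
  · rw [Real.sqrt_sq hp.le, smul_smul]; congr 1; field_simp
  · rw [Real.sqrt_sq hp.le, norm_smul]; simp; field_simp; ring

theorem HasGradLap.rpow {f : V → ℝ} {x G : V} {l : ℝ} (hf : HasGradLap f x G l) (hx : 0 < f x)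
    (q : ℝ) : HasGradLap (fun y => f y ^ q) x ((q * f x ^ (q - 1)) • G)
      (q * ((q - 1) * f x ^ (q - 2)) * ‖G‖ ^ 2 + q * f x ^ (q - 1) * l) := by
  refine hf.comp (φ := fun t => t ^ q) (φ' := fun t => q * t ^ (q - 1))
    (Real.contDiffAt_rpow_const_of_ne hx.ne') ?_ ?_
  · filter_upwards [lt_mem_nhds hx] with t ht
    exact Real.hasDerivAt_rpow_const (Or.inl ht.ne')
  · have := (Real.hasDerivAt_rpow_const (p := q - 1) (Or.inl hx.ne')).const_mul q
    refine this.congr_deriv ?_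
    rw [show q - 1 - 1 = q - 2 by ring]

theorem HasGradLap.inv {f : V → ℝ} {x G : V} {l : ℝ} (hf : HasGradLap f x G l) (hx : f x ≠ 0) :
    HasGradLap (fun y => (f y)⁻¹) x (-((f x ^ 2)⁻¹) • G)
      (2 / f x ^ 3 * ‖G‖ ^ 2 - l / f x ^ 2) := by
  have h2 : HasDerivAt (fun t : ℝ => -((t ^ 2)⁻¹)) (2 / f x ^ 3) (f x) := by
    have := ((hasDerivAt_pow 2 (f x)).inv (pow_ne_zero 2 hx)).neg
    refine this.congr_deriv ?_
    field_simp
    norm_num [mul_comm]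
  refine (hf.comp (φ := fun t => t⁻¹) (φ' := fun t => -((t ^ 2)⁻¹)) (contDiffAt_inv ℝ hx)
    ?_ h2).congr_val rfl (by ring)
  filter_upwards [isOpen_ne.mem_nhds hx] with t ht
  exact hasDerivAt_inv ht

/-! ### The weak maximum principle -/

/-- At an interior local maximum the Laplacian is not positive. -/
theorem laplacian_nonpos_of_isLocalMax {f : V → ℝ} {x : V} (hf : ContDiffAt ℝ 2 f x)
    (hm : IsLocalMax f x) : Δ f x ≤ 0 := by
  have b := stdOrthonormalBasis ℝ V
  rw [laplacian_eq_sum_fderiv b]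
  refine Finset.sum_nonpos fun i _ => ?_
  by_contra! hpos
  set v := b i
  set g : ℝ → ℝ := fun t => f (x + t • v) with hg
  have hline : ∀ t : ℝ, HasDerivAt (fun t : ℝ => x + t • v) v t := fun t => by
    simpa using ((hasDerivAt_id t).smul_const v).const_add x
  have hlc : Tendsto (fun t : ℝ => x + t • v) (𝓝 0) (𝓝 x) := by
    simpa using (hline 0).continuousAt.tendsto
  have hd1 : deriv g =ᶠ[𝓝 0] fun t => fderiv ℝ f (x + t • v) v := by
    filter_upwards [hlc.eventually (eventually_differentiableAt_of_contDiffAt_two hf)] with t ht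
    exact (ht.hasFDerivAt.comp_hasDerivAt t (hline t)).deriv
  have hd2 : deriv (deriv g) 0 = fderiv ℝ (fderiv ℝ f) x v v := by
    rw [hd1.deriv_eq]
    have h0 : HasFDerivAt (fderiv ℝ f) (fderiv ℝ (fderiv ℝ f) x) (x + (0 : ℝ) • v) := by
      simpa using (differentiableAt_fderiv_of_contDiffAt_two hf).hasFDerivAt
    have h1 := h0.comp_hasDerivAt (0 : ℝ) (hline 0)
    exact (h1.clm_apply (hasDerivAt_const (0 : ℝ) v)).deriv.trans (by simp)
  have hgm : IsLocalMax g 0 := by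
    have : ∀ᶠ y in 𝓝 x, f y ≤ f x := hm
    filter_upwards [hlc.eventually this] with t ht
    simpa [hg] using ht
  have hgc : ContinuousAt g 0 := by
    have h0 : ContinuousAt f (x + (0 : ℝ) • v) := by simpa using hf.continuousAt
    exact ContinuousAt.comp (f := fun t : ℝ => x + t • v) h0 (hline 0).continuousAt
  have hmin : IsLocalMin g 0 :=
    isLocalMin_of_deriv_deriv_pos (by rw [hd2]; exact hpos) hgm.deriv_eq_zero hgc
  have hconst : g =ᶠ[𝓝 0] fun _ => g 0 := by
    filter_upwards [hmin, hgm] with t h1 h2 using le_antisymm h2 h1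
  have : deriv (deriv g) 0 = 0 := by
    rw [hconst.deriv.deriv_eq]; simp
  rw [hd2] at this
  exact hpos.ne' this

/-- The weak maximum principle on a bounded open set, for a function that is subharmonic where it
is positive. -/
theorem nonpos_of_subharmonic {D : Set V} (hD : IsOpen D) (hb : Bornology.IsBounded D)
    (hV : 0 < Module.finrank ℝ V) {f : V → ℝ}
    (hc : ∀ x ∈ D, ContDiffAt ℝ 2 f x) (hsub : ∀ x ∈ D, 0 < f x → 0 ≤ Δ f x)
    (hbd : ∀ p ∈ closure D, p ∉ D → ∀ ε > 0, ∀ᶠ x in 𝓝[D] p, f x < ε) :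
    ∀ x ∈ D, f x ≤ 0 := by
  by_contra! hne
  obtain ⟨x₀, hx₀, hpos⟩ := hne
  obtain ⟨R, hR, hDR⟩ := hb.exists_pos_norm_le
  -- The perturbation `τ (|x|² - R²)` makes `f` strictly subharmonic without moving `f x₀` by half.
  set m := f x₀ with hm
  set τ := m / (2 * R ^ 2) with hτ
  have hτ0 : 0 < τ := by positivity
  set g : V → ℝ := fun x => f x + (τ * ‖x‖ ^ 2 + -(τ * R ^ 2)) with hg
  have hgf : ∀ x ∈ D, g x ≤ f x := fun x hx => by
    have h1 : ‖x‖ ^ 2 ≤ R ^ 2 := pow_le_pow_left₀ (norm_nonneg _) (hDR x hx) 2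
    have h2 := mul_le_mul_of_nonneg_left h1 hτ0.le
    simp only [hg]; linarith
  have hg0 : m / 2 ≤ g x₀ := by
    have : τ * R ^ 2 = m / 2 := by rw [hτ]; field_simp
    have h3 : 0 ≤ τ * ‖x₀‖ ^ 2 := by positivity
    simp only [hg, this, ← hm]; linarith
  have hgc : ∀ x ∈ D, ContinuousAt g x := fun x hx =>
    (hc x hx).continuousAt.add (by fun_prop)
  set K := {x | x ∈ D ∧ m / 2 ≤ g x} with hK
  have hKcl : IsClosed K := by
    refine isClosed_of_closure_subset fun p hp => ?_
    have hpD : p ∈ closure D := closure_mono (fun x hx => hx.1) hp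
    have hfreq : ∃ᶠ x in 𝓝 p, x ∈ K := mem_closure_iff_frequently.1 hp
    by_cases hpin : p ∈ D
    · refine ⟨hpin, ?_⟩
      by_contra! hlt
      exact hfreq (((hgc p hpin).eventually_lt continuousAt_const hlt).mono
        fun x hx hxK => absurd hxK.2 (not_le.2 hx))
    · exfalso
      have := eventually_nhdsWithin_iff.1 (hbd p hpD hpin (m / 2) (by positivity))
      exact hfreq (this.mono fun x hx hxK =>
        absurd (hxK.2.trans (hgf x hxK.1)) (not_le.2 (hx hxK.1)))
  have hKc : IsCompact K :=
    Metric.isCompact_of_isClosed_isBounded hKcl (hb.subset fun x hx => hx.1)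
  obtain ⟨z, hzK, hzmax⟩ := hKc.exists_isMaxOn ⟨x₀, hx₀, hg0⟩
    (fun x hx => (hgc x hx.1).continuousWithinAt)
  have hloc : IsLocalMax g z := by
    filter_upwards [hD.mem_nhds hzK.1] with y hy
    by_cases hyK : m / 2 ≤ g y
    · exact hzmax ⟨hy, hyK⟩
    · exact (not_le.1 hyK).le.trans hzK.2
  have hgl := (hasGradLap_of_contDiffAt (hc z hzK.1)).add
    (((hasGradLap_norm_sq z).const_mul τ).add (hasGradLap_const (-(τ * R ^ 2)) z))
  have h1 := laplacian_nonpos_of_isLocalMax hgl.contDiffAt hloc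
  rw [hgl.laplacian_eq] at h1
  have h2 := hsub z hzK.1 (by have := hzK.2.trans (hgf z hzK.1); linarith [half_pos hpos])
  have h3 : (0 : ℝ) < Module.finrank ℝ V := by exact_mod_cast hV
  have : 0 < τ * (2 * Module.finrank ℝ V) := by positivity
  linarith

end GradLap

/-! ### The chambers in terms of the heights over the vertices -/

/-- The height of `x` in the direction of the vertex `p_j`. -/
def height (j : Fin 4) (x : E) : ℝ := inner ℝ (vertex j) x

theorem sqrt_three_inv_sq : (√3 : ℝ)⁻¹ * (√3)⁻¹ = 1 / 3 := by
  rw [← mul_inv, Real.mul_self_sqrt (by norm_num)]; norm_num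

theorem inner_vertex (i j : Fin 4) :
    inner ℝ (vertex i) (vertex j) = if i = j then 1 else (-(1 / 3) : ℝ) := by
  have h : ∀ v w : E, inner ℝ ((√3)⁻¹ • v) ((√3)⁻¹ • w) = (1 / 3 : ℝ) * inner ℝ v w := by
    intro v w
    rw [real_inner_smul_left, real_inner_smul_right, ← mul_assoc, sqrt_three_inv_sq]
  rw [vertex, vertex, h]
  fin_cases i <;> fin_cases j <;>
    simp [PiLp.inner_apply, Fin.sum_univ_three, EuclideanSpace.norm_sq_eq] <;> norm_num

theorem norm_vertex (j : Fin 4) : ‖vertex j‖ = 1 := by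
  have := inner_vertex j j
  rw [if_pos rfl, real_inner_self_eq_norm_sq] at this
  nlinarith [norm_nonneg (vertex j)]

theorem height_vertex (i j : Fin 4) : height i (vertex j) = if i = j then 1 else (-(1 / 3) : ℝ) :=
  inner_vertex i j

theorem height_add (j : Fin 4) (x y : E) : height j (x + y) = height j x + height j y :=
  inner_add_right _ _ _

theorem height_smul (j : Fin 4) (t : ℝ) (x : E) : height j (t • x) = t * height j x :=
  inner_smul_right _ _ _

theorem continuous_height (j : Fin 4) : Continuous (height j) := by
  unfold height; fun_prop

/-- The vertices form a tight frame with constant `4 / 3`. -/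
theorem sum_height_smul_vertex (x : E) : ∑ j, height j x • vertex j = (4 / 3 : ℝ) • x := by
  have h : ∀ v : E, (inner ℝ ((√3)⁻¹ • v) x : ℝ) • ((√3)⁻¹ • v) = (1 / 3 * inner ℝ v x : ℝ) • v := by
    intro v
    rw [real_inner_smul_left, smul_smul, mul_right_comm, sqrt_three_inv_sq]
  simp only [height, vertex, h]
  ext i
  fin_cases i <;>
    simp [PiLp.inner_apply, Fin.sum_univ_three, Fin.sum_univ_four] <;> ring

theorem sum_vertex : ∑ j, vertex j = 0 := by
  simp only [vertex, ← Finset.smul_sum]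
  ext i
  fin_cases i <;> simp [Fin.sum_univ_four]

theorem sum_height (x : E) : ∑ j, height j x = 0 := by
  simp only [height, ← sum_inner, sum_vertex, inner_zero_left]

theorem sum_height_sq (x : E) : ∑ j, height j x ^ 2 = 4 / 3 * ‖x‖ ^ 2 := by
  have := congrArg (fun y => inner ℝ y x) (sum_height_smul_vertex x)
  simp only [sum_inner, real_inner_smul_left, real_inner_self_eq_norm_sq] at this
  rw [← this]
  exact Finset.sum_congr rfl fun j _ => by rw [sq]; rfl

theorem eq_sum_smul_vertex (x : E) (c : ℝ) :
    x = ∑ j, (3 / 4 * (height j x - c)) • vertex j := by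
  have : ∑ j, (3 / 4 * (height j x - c)) • vertex j
      = (3 / 4 : ℝ) • ∑ j, height j x • vertex j - (3 / 4 * c) • ∑ j, vertex j := by
    rw [Finset.smul_sum, Finset.smul_sum, ← Finset.sum_sub_distrib]
    refine Finset.sum_congr rfl fun j _ => ?_
    rw [smul_smul, ← sub_smul]; congr 1; ring
  rw [this, sum_height_smul_vertex, sum_vertex, smul_smul]; norm_num

/-- The indices `k, a, b, c` are `0, 1, 2, 3` in some order. -/
def IsOrder (k a b c : Fin 4) : Prop :=
  k ≠ a ∧ k ≠ b ∧ k ≠ c ∧ a ≠ b ∧ a ≠ c ∧ b ≠ c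

instance (k a b c : Fin 4) : Decidable (IsOrder k a b c) := by
  unfold IsOrder; infer_instance

theorem exists_isOrder : ∀ k : Fin 4, ∃ a b c, IsOrder k a b c := by decide

theorem exists_isOrder_two : ∀ k a : Fin 4, k ≠ a → ∃ b c, IsOrder k a b c := by decide

theorem IsOrder.rotate {k a b c : Fin 4} (h : IsOrder k a b c) : IsOrder k b c a := by
  revert k a b c; decide

theorem IsOrder.swap {k a b c : Fin 4} (h : IsOrder k a b c) : IsOrder a k b c := by
  revert k a b c; decide

theorem IsOrder.eq_or {k a b c : Fin 4} (h : IsOrder k a b c) (j : Fin 4) :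
    j = k ∨ j = a ∨ j = b ∨ j = c := by
  revert k a b c j; decide

theorem IsOrder.univ_eq {k a b c : Fin 4} (h : IsOrder k a b c) :
    (Finset.univ : Finset (Fin 4)) = {k, a, b, c} := by
  revert k a b c; decide

theorem IsOrder.sum_eq {M : Type*} [AddCommMonoid M] {k a b c : Fin 4} (h : IsOrder k a b c)
    (f : Fin 4 → M) : ∑ j, f j = f k + f a + f b + f c := by
  obtain ⟨h1, h2, h3, h4, h5, h6⟩ := h
  rw [IsOrder.univ_eq ⟨h1, h2, h3, h4, h5, h6⟩, Finset.sum_insert (by simp [h1, h2, h3]),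
    Finset.sum_insert (by simp [h4, h5]), Finset.sum_insert (by simp [h6]), Finset.sum_singleton]
  abel

theorem IsOrder.height_sum {k a b c : Fin 4} (h : IsOrder k a b c) (x : E) :
    height k x + height a x + height b x + height c x = 0 := by
  rw [← h.sum_eq fun j => height j x, sum_height]

theorem IsOrder.height_sq_sum {k a b c : Fin 4} (h : IsOrder k a b c) (x : E) :
    height k x ^ 2 + height a x ^ 2 + height b x ^ 2 + height c x ^ 2 = 4 / 3 * ‖x‖ ^ 2 := by
  rw [← h.sum_eq fun j => height j x ^ 2, sum_height_sq]

/-- The chamber `C_k` is the set of points whose height over `p_k` is the strictly smallest one. -/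
theorem mem_chamber_iff {k : Fin 4} {x : E} :
    x ∈ chamber k ↔ ∀ j, j ≠ k → height k x < height j x := by
  constructor
  · rintro ⟨t, htk, htpos, rfl⟩ j hj
    obtain ⟨b, c, ho⟩ := exists_isOrder_two k j hj.symm
    have ⟨h1, h2, h3, h4, h5, h6⟩ := ho
    have := htpos j hj
    rw [ho.sum_eq]
    simp only [height_add, height_smul, height_vertex, htk, h1, h2, h3, h4, h5, h1.symm,
      if_true, if_false]
    linarith
  · intro h
    refine ⟨fun j => 3 / 4 * (height j x - height k x), by simp, fun j hj => ?_,
      eq_sum_smul_vertex x _⟩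
    have := h j hj
    linarith

theorem IsOrder.mem_chamber_iff {k a b c : Fin 4} (h : IsOrder k a b c) {x : E} :
    x ∈ chamber k ↔ height k x < height a x ∧ height k x < height b x ∧
      height k x < height c x := by
  rw [TetraZ2.mem_chamber_iff]
  refine ⟨fun H => ⟨H a h.1.symm, H b h.2.1.symm, H c h.2.2.1.symm⟩, fun H j hj => ?_⟩
  rcases h.eq_or j with rfl | rfl | rfl | rfl
  · exact absurd rfl hj
  · exact H.1
  · exact H.2.1
  · exact H.2.2

theorem isOpen_chamber (k : Fin 4) : IsOpen (chamber k) := by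
  obtain ⟨a, b, c, h⟩ := exists_isOrder k
  have : chamber k = {x | height k x < height a x} ∩ ({x | height k x < height b x} ∩
      {x | height k x < height c x}) := by ext x; exact h.mem_chamber_iff
  rw [this]
  exact (isOpen_lt (continuous_height _) (continuous_height _)).inter
    ((isOpen_lt (continuous_height _) (continuous_height _)).inter
    (isOpen_lt (continuous_height _) (continuous_height _)))

theorem height_le_of_mem_closure_chamber {k : Fin 4} {x : E} (hx : x ∈ closure (chamber k))
    (j : Fin 4) : height k x ≤ height j x := by
  have hcl : IsClosed {x | height k x ≤ height j x} :=
    isClosed_le (continuous_height _) (continuous_height _)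
  refine closure_minimal (fun y hy => ?_) hcl hx
  by_cases hj : j = k
  · subst hj; exact le_refl (height j y)
  · exact (mem_chamber_iff.1 hy j hj).le

theorem smul_mem_chamber {k : Fin 4} {x : E} {t : ℝ} (ht : 0 < t) :
    t • x ∈ chamber k ↔ x ∈ chamber k := by
  simp only [mem_chamber_iff, height_smul, mul_lt_mul_iff_right₀ ht]

/-- On a wall the heights over the other vertices are the smallest ones, and equal. -/
theorem height_of_mem_wall {i j : Fin 4} {x : E} (hx : x ∈ wall i j) {m : Fin 4} (hmi : m ≠ i)
    (hmj : m ≠ j) :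
    ∀ n, height m x ≤ height n x ∧ (n ≠ i → n ≠ j → height n x = height m x) := by
  obtain ⟨s, t, hs, ht, rfl⟩ := hx
  intro n
  simp only [height_add, height_smul, height_vertex, hmi, hmj, if_false]
  constructor
  · split_ifs <;> nlinarith
  · intro h1 h2; simp [h1, h2]

theorem mem_wall_of_height {k a b c : Fin 4} (h : IsOrder k a b c) {x : E}
    (h1 : height k x = height a x) (hb : height k x ≤ height b x) (hc : height k x ≤ height c x) :
    x ∈ wall b c := by
  refine ⟨3 / 4 * (height b x - height k x), 3 / 4 * (height c x - height k x), by linarith,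
    by linarith, ?_⟩
  conv_lhs => rw [eq_sum_smul_vertex x (height k x)]
  rw [h.sum_eq, ← h1]
  simp

theorem exists_three (i j : Fin 4) : ∃ m n, m ≠ n ∧ m ≠ i ∧ m ≠ j ∧ n ≠ i ∧ n ≠ j := by
  revert i j; decide

theorem chamber_subset_chart (k a : Fin 4) : chamber k ⊆ chart a := by
  intro x hx hmem
  obtain ⟨b, hb⟩ := mem_iUnion.1 hmem
  obtain ⟨m, n, hmn, hma, hmb, hna, hnb⟩ := exists_three a b
  have h1 := height_of_mem_wall hb hma hmb
  have hk := h1 k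
  rw [mem_chamber_iff] at hx
  by_cases hm : m = k
  · subst hm
    exact (hx n hmn.symm).ne' ((h1 n).2 hna hnb)
  · exact absurd hk.1 (not_le.2 (hx m hm))

theorem mem_chart_of_interior_wall {k a b c : Fin 4} (h : IsOrder k a b c) {x : E}
    (h1 : height k x = height a x) (hb : height k x < height b x) (hc : height k x < height c x) :
    x ∈ chart k := by
  intro hmem
  obtain ⟨d, hd⟩ := mem_iUnion.1 hmem
  obtain ⟨m, n, hmn, hmk, hmd, hnk, hnd⟩ := exists_three k d
  have h2 := height_of_mem_wall hd hmk hmd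
  have h3 := (h2 n).2 hnk hnd
  have h4 := (h2 k).1
  have key : ∀ j, j ≠ k → height j x ≤ height k x → j = a := by
    intro j hj hle
    rcases h.eq_or j with rfl | rfl | rfl | rfl
    · exact absurd rfl hj
    · rfl
    · exact absurd hle (not_le.2 hb)
    · exact absurd hle (not_le.2 hc)
  exact hmn ((key m hmk h4).trans (key n hnk (h3.le.trans h4)).symm)

theorem mem_ray_of_height {k a b c : Fin 4} (h : IsOrder k a b c) {x : E}
    (h1 : height k x = height a x) (hb : height k x = height b x) (hc : height k x ≤ height c x) :
    x ∈ ray c := by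
  refine ⟨3 / 4 * (height c x - height k x), by linarith, ?_⟩
  conv_lhs => rw [eq_sum_smul_vertex x (height k x)]
  rw [h.sum_eq, ← h1, ← hb]
  simp

/-- The relative interior of the wall between `C_k` and `C_a`. -/
def openWall (k a : Fin 4) : Set E :=
  {x | height k x = height a x ∧ ∀ j, j ≠ k → j ≠ a → height k x < height j x}

/-- A boundary point of a chamber lies in the interior of one of its walls or on one of its
rays. -/
theorem mem_openWall_or_ray {k : Fin 4} {x : E} (hx : ∀ j, height k x ≤ height j x)
    (hn : x ∉ chamber k) :
    (∃ a, a ≠ k ∧ x ∈ openWall k a) ∨ ∃ j, j ≠ k ∧ x ∈ ray j := by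
  rw [mem_chamber_iff] at hn
  push Not at hn
  obtain ⟨a, hak, hle⟩ := hn
  have hka := le_antisymm (hx a) hle
  by_cases hw : ∀ j, j ≠ k → j ≠ a → height k x < height j x
  · exact Or.inl ⟨a, hak, hka, hw⟩
  · push Not at hw
    obtain ⟨b, hbk, hba, hle'⟩ := hw
    have hkb := le_antisymm (hx b) hle'
    obtain ⟨c, hc⟩ : ∃ c, IsOrder k a b c := by
      clear * - hak hbk hba; revert k a b; decide
    exact Or.inr ⟨c, hc.2.2.1.symm, mem_ray_of_height hc hka hkb (hx c)⟩

theorem openWall_subset_chart {k a : Fin 4} (hka : k ≠ a) : openWall k a ⊆ chart k ∩ chart a := by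
  rintro x ⟨h1, h2⟩
  obtain ⟨b, c, h⟩ := exists_isOrder_two k a hka
  have hb := h2 b h.2.1.symm h.2.2.2.1.symm
  have hc := h2 c h.2.2.1.symm h.2.2.2.2.1.symm
  exact ⟨mem_chart_of_interior_wall h h1 hb hc,
    mem_chart_of_interior_wall h.swap h1.symm (h1 ▸ hb) (h1 ▸ hc)⟩

/-- A point of a chart lies in a chamber or in the interior of one of the three walls that the
chart contains. -/
theorem mem_chamber_or_openWall {a : Fin 4} {x : E} (hx : x ∈ chart a) :
    (∃ k, x ∈ chamber k) ∨ ∃ b, a ≠ b ∧ x ∈ openWall a b := by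
  obtain ⟨k, -, hk⟩ := Finset.exists_min_image (Finset.univ : Finset (Fin 4)) (fun j => height j x)
    ⟨0, Finset.mem_univ _⟩
  replace hk : ∀ j, height k x ≤ height j x := fun j => hk j (Finset.mem_univ j)
  -- Two minimal heights over vertices other than `p_a` put `x` on a wall through `p_a`.
  have key : ∀ c d, c ≠ d → c ≠ a → d ≠ a → (∀ j, height c x ≤ height j x) →
      height c x ≠ height d x := by
    intro c d hcd hca hda hmin heq
    obtain ⟨b, hb⟩ : ∃ b, IsOrder c d a b := by
      clear * - hcd hca hda; revert c d a; decide
    exact hx (mem_iUnion.2 ⟨b, mem_wall_of_height hb heq (hmin _) (hmin _)⟩)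
  by_cases hka : k = a
  · subst hka
    by_cases hc : x ∈ chamber k
    · exact Or.inl ⟨k, hc⟩
    · rw [mem_chamber_iff] at hc
      push Not at hc
      obtain ⟨b, hbk, hle⟩ := hc
      have hkb := le_antisymm (hk b) hle
      refine Or.inr ⟨b, hbk.symm, hkb, fun j hjk hjb => lt_of_le_of_ne (hk j) fun h => ?_⟩
      exact key b j hjb.symm hbk hjk (fun i => hkb ▸ hk i) (hkb ▸ h)
  · by_cases hak : height a x = height k x
    · refine Or.inr ⟨k, Ne.symm hka, hak, fun j hja hjk => lt_of_le_of_ne (hak ▸ hk j) fun h => ?_⟩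
      exact key k j (Ne.symm hjk) hka hja hk (hak ▸ h)
    · refine Or.inl ⟨k, mem_chamber_iff.2 fun j hj => lt_of_le_of_ne (hk j) fun h => ?_⟩
      by_cases hja : j = a
      · subst hja; exact hak h.symm
      · exact key k j (Ne.symm hj) hka hja hk h

theorem isClosed_wall (i j : Fin 4) : IsClosed (wall i j) := by
  obtain ⟨m, n, hmn, hmi, hmj, hni, hnj⟩ := exists_three i j
  by_cases hij : i = j
  · subst hij
    obtain ⟨b, hb⟩ : ∃ b, IsOrder b m n i := by
      clear * - hmn hmi hni; revert m n i; decide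
    have : wall i i = {x | height b x = height m x} ∩ ({x | height b x = height n x} ∩
        {x | height b x ≤ height i x}) := by
      ext x
      constructor
      · intro hx
        have := height_of_mem_wall hx hb.2.2.1 hb.2.2.1
        exact ⟨((this m).2 hmi hmi).symm, ((this n).2 hni hni).symm, (this i).1⟩
      · rintro ⟨h1, h2, h3⟩
        obtain ⟨t, ht, h⟩ := mem_ray_of_height hb h1 h2 h3
        exact ⟨t, 0, ht, le_rfl, by simpa using h⟩
    rw [this]
    exact (isClosed_eq (continuous_height _) (continuous_height _)).inter
      ((isClosed_eq (continuous_height _) (continuous_height _)).inter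
        (isClosed_le (continuous_height _) (continuous_height _)))
  · have ho : IsOrder m n i j := ⟨hmn, hmi, hmj, hni, hnj, hij⟩
    have : wall i j = {x | height m x = height n x} ∩ ({x | height m x ≤ height i x} ∩
        {x | height m x ≤ height j x}) := by
      ext x
      constructor
      · intro hx
        have := height_of_mem_wall hx hmi hmj
        exact ⟨((this n).2 hni hnj).symm, (this i).1, (this j).1⟩
      · rintro ⟨h1, h2, h3⟩
        exact mem_wall_of_height ho h1 h2 h3
    rw [this]
    exact (isClosed_eq (continuous_height _) (continuous_height _)).inter
      ((isClosed_le (continuous_height _) (continuous_height _)).inter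
        (isClosed_le (continuous_height _) (continuous_height _)))

theorem isOpen_chart (a : Fin 4) : IsOpen (chart a) :=
  (isClosed_iUnion_of_finite fun b => isClosed_wall a b).isOpen_compl

theorem smul_mem_wall {i j : Fin 4} {x : E} {t : ℝ} (ht : 0 < t) :
    t • x ∈ wall i j ↔ x ∈ wall i j := by
  constructor
  · rintro ⟨a, b, ha, hb, h⟩
    refine ⟨t⁻¹ * a, t⁻¹ * b, by positivity, by positivity, ?_⟩
    rw [← inv_smul_smul₀ ht.ne' x, h, smul_add, smul_smul, smul_smul]
  · rintro ⟨a, b, ha, hb, rfl⟩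
    exact ⟨t * a, t * b, by positivity, by positivity, by rw [smul_add, smul_smul, smul_smul]⟩

theorem smul_mem_chart {a : Fin 4} {x : E} {t : ℝ} (ht : 0 < t) :
    t • x ∈ chart a ↔ x ∈ chart a := by
  simp [chart, smul_mem_wall ht]

theorem smul_mem_openWall {k a : Fin 4} {x : E} {t : ℝ} (ht : 0 < t) :
    t • x ∈ openWall k a ↔ x ∈ openWall k a := by
  simp [openWall, height_smul, mul_lt_mul_iff_right₀ ht, ht.ne']

theorem zero_notMem_chart (a : Fin 4) : (0 : E) ∉ chart a := fun h =>
  h (mem_iUnion.2 ⟨a, 0, 0, le_rfl, le_rfl, by simp⟩)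

theorem ne_zero_of_mem_chamber {k : Fin 4} {x : E} (hx : x ∈ chamber k) : x ≠ 0 := by
  rintro rfl
  exact zero_notMem_chart k (chamber_subset_chart k k hx)

/-! ### Sections vanish on the walls -/

theorem transition_of_openWall {a b : Fin 4} {x : E} (hx : x ∈ openWall a b) :
    transition a b x = -1 := by
  rw [transition, if_neg]
  rintro ⟨c, hca, hcb, hc⟩
  exact lt_asymm (hx.2 c hca hcb) (mem_chamber_iff.1 hc a hca.symm)

theorem abs_transition (a b : Fin 4) (x : E) : |transition a b x| = 1 := by
  unfold transition; split_ifs <;> simp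

theorem IsSection.abs_eq {U : Set E} {u : Fin 4 → E → ℝ} (hs : IsSection U u) {a b : Fin 4} {x : E}
    (hx : x ∈ U) (ha : x ∈ chart a) (hb : x ∈ chart b) : |u a x| = |u b x| := by
  by_cases hab : a = b
  · rw [hab]
  · rw [hs a b hab x ⟨hx, ha, hb⟩, abs_mul, abs_transition, one_mul]

theorem mem_mirrorPlane_of_openWall {a b : Fin 4} (hab : a ≠ b) {x : E} (hx : x ∈ openWall a b) :
    x ∈ mirrorPlane a b := by
  obtain ⟨c, d, h⟩ := exists_isOrder_two a b hab
  rw [eq_sum_smul_vertex x (height a x), h.sum_eq, ← hx.1]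
  simp only [sub_self, mul_zero, zero_smul, zero_add]
  exact add_mem (Submodule.smul_mem _ _ (Submodule.subset_span ⟨c, h.2.1.symm, h.2.2.2.1.symm, rfl⟩))
    (Submodule.smul_mem _ _ (Submodule.subset_span ⟨d, h.2.2.1.symm, h.2.2.2.2.1.symm, rfl⟩))

/-- Equivariance under the reflection in a wall, whose lift is the identity over the wall, forces
an equivariant section to vanish there. -/
theorem IsEquivariant.eq_zero {U : Set E} {u : Fin 4 → E → ℝ} (hs : IsSection U u)
    (he : IsEquivariant U u) {a b : Fin 4} (hab : a ≠ b) {x : E} (hx : x ∈ U)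
    (hw : x ∈ openWall a b) : u a x = 0 := by
  have hc := openWall_subset_chart hab hw
  have h1 := he a b hab a x ⟨hx, hc.1⟩
  have h2 := hs a b hab x ⟨hx, hc⟩
  have h3 : mirror a b x = x :=
    Submodule.reflection_mem_subspace_eq_self (mem_mirrorPlane_of_openWall hab hw)
  rw [transition_of_openWall hw] at h2
  simp only [reflectSection, Equiv.swap_apply_left, h3] at h1
  linarith

/-! ### Harmonic functions of a lune -/

/-- The coordinate of `x` in the plane orthogonal to `p_j`, as a complex number, where `k, a, b` are
the indices other than `j`.  The positive real axis bisects the projection of the chamber `C_k`,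
which is the sector `|arg ζ| < π / 3`. -/
def luneCoord (k a b : Fin 4) : E →L[ℝ] ℂ :=
  (innerSL ℝ ((2 * √2)⁻¹ • (vertex a + vertex b - (2 : ℝ) • vertex k))).smulRight (1 : ℂ) +
    (innerSL ℝ ((√3 / (2 * √2)) • (vertex a - vertex b))).smulRight Complex.I

theorem luneCoord_apply (k a b : Fin 4) (x : E) : luneCoord k a b x =
    (inner ℝ ((2 * √2)⁻¹ • (vertex a + vertex b - (2 : ℝ) • vertex k)) x : ℝ) • (1 : ℂ) +
    (inner ℝ ((√3 / (2 * √2)) • (vertex a - vertex b)) x : ℝ) • Complex.I := rfl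

theorem luneCoord_re (k a b : Fin 4) (x : E) : (luneCoord k a b x).re =
    (2 * √2)⁻¹ * ((height a x - height k x) + (height b x - height k x)) := by
  rw [luneCoord_apply, Complex.add_re, Complex.smul_re, Complex.smul_re]
  simp only [height, inner_add_left, inner_sub_left, real_inner_smul_left, Complex.one_re,
    Complex.I_re, smul_eq_mul]
  ring

theorem luneCoord_im (k a b : Fin 4) (x : E) : (luneCoord k a b x).im =
    √3 / (2 * √2) * ((height a x - height k x) - (height b x - height k x)) := by
  rw [luneCoord_apply, Complex.add_im, Complex.smul_im, Complex.smul_im]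
  simp only [height, inner_sub_left, real_inner_smul_left, Complex.one_im,
    Complex.I_im, smul_eq_mul]
  ring

theorem norm_sq_luneCoord {k j a b : Fin 4} (h : IsOrder k j a b) (x : E) :
    ‖luneCoord k a b x‖ ^ 2 = ‖x‖ ^ 2 - height j x ^ 2 := by
  have h1 := h.height_sum x
  have h2 := h.height_sq_sum x
  have e1 : ((2 * √2)⁻¹) ^ 2 = (1 / 8 : ℝ) := by
    rw [inv_pow, mul_pow, Real.sq_sqrt (by norm_num)]; norm_num
  have e2 : (√3 / (2 * √2)) ^ 2 = (3 / 8 : ℝ) := by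
    rw [div_pow, mul_pow, Real.sq_sqrt (by norm_num), Real.sq_sqrt (by norm_num)]; norm_num
  rw [Complex.sq_norm, Complex.normSq_apply, ← sq, ← sq, luneCoord_re, luneCoord_im, mul_pow,
    mul_pow, e1, e2]
  have h3 : height j x = -(height k x + height a x + height b x) := by linarith
  have h4 : ‖x‖ ^ 2 = 3 / 4 * (height k x ^ 2 + height j x ^ 2 + height a x ^ 2 +
    height b x ^ 2) := by linarith
  rw [h4, h3]
  ring

theorem norm_luneCoord_le {k j a b : Fin 4} (h : IsOrder k j a b) (x : E) :
    ‖luneCoord k a b x‖ ≤ ‖x‖ := by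
  have := norm_sq_luneCoord h x
  exact le_of_sq_le_sq (by nlinarith [sq_nonneg (height j x)]) (norm_nonneg x)

theorem luneCoord_vertex {k j a b : Fin 4} (h : IsOrder k j a b) :
    luneCoord k a b (vertex j) = 0 := by
  obtain ⟨h1, h2, h3, h4, h5, h6⟩ := h
  apply Complex.ext
  · rw [luneCoord_re]; simp [height_vertex, h1, h4.symm, h5.symm]
  · rw [luneCoord_im]; simp [height_vertex, h4.symm, h5.symm]

theorem luneCoord_ray {k j a b : Fin 4} (h : IsOrder k j a b) {p : E} (hp : p ∈ ray j) :
    luneCoord k a b p = 0 := by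
  obtain ⟨t, -, rfl⟩ := hp
  rw [map_smul, luneCoord_vertex h, smul_zero]

theorem luneCoord_re_pos {k j a b : Fin 4} (h : IsOrder k j a b) {x : E} (hx : x ∈ chamber k) :
    0 < (luneCoord k a b x).re := by
  rw [luneCoord_re]
  have := h.mem_chamber_iff.1 hx
  have h1 := sub_pos.2 this.2.1
  have h2 := sub_pos.2 this.2.2
  positivity

theorem luneCoord_mem_slitPlane {k j a b : Fin 4} (h : IsOrder k j a b) {x : E}
    (hx : x ∈ chamber k) : luneCoord k a b x ∈ Complex.slitPlane :=
  Or.inl (luneCoord_re_pos h hx)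

theorem norm_luneCoord_pos {k j a b : Fin 4} (h : IsOrder k j a b) {x : E} (hx : x ∈ chamber k) :
    0 < ‖luneCoord k a b x‖ :=
  norm_pos_iff.2 (Complex.slitPlane_ne_zero (luneCoord_mem_slitPlane h hx))

theorem abs_arg_luneCoord_le {k j a b : Fin 4} (h : IsOrder k j a b) {x : E} (hx : x ∈ chamber k) :
    |(luneCoord k a b x).arg| ≤ Real.pi / 3 := by
  set ζ := luneCoord k a b x with hζ
  have hpos := norm_luneCoord_pos h hx
  have hre := luneCoord_re_pos h hx
  have hcos : Real.cos (Real.pi / 3) ≤ Real.cos |ζ.arg| := by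
    rw [Real.cos_abs, Complex.cos_arg (norm_pos_iff.1 hpos), Real.cos_pi_div_three,
      le_div_iff₀ hpos]
    have hn : ‖ζ‖ ^ 2 = ζ.re ^ 2 + ζ.im ^ 2 := by
      rw [Complex.sq_norm, Complex.normSq_apply, sq, sq]
    have hY : ζ.im ^ 2 ≤ 3 * ζ.re ^ 2 := by
      have := h.mem_chamber_iff.1 hx
      have h1 := sub_pos.2 this.2.1
      have h2 := sub_pos.2 this.2.2
      rw [hζ, luneCoord_re, luneCoord_im, div_eq_mul_inv, mul_pow, mul_pow, mul_pow,
        Real.sq_sqrt (by norm_num)]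
      have h3 : 0 ≤ ((2 * √2)⁻¹ : ℝ) ^ 2 := by positivity
      have h4 := mul_nonneg h3 (mul_pos h1 h2).le
      nlinarith
    have : ‖ζ‖ ^ 2 ≤ (2 * ζ.re) ^ 2 := by nlinarith
    have := le_of_sq_le_sq this (by positivity)
    linarith
  by_contra! hlt
  exact absurd hcos (not_le.2 (Real.cos_lt_cos_of_nonneg_of_le_pi (by positivity)
    (Complex.abs_arg_le_pi _) hlt))

theorem sum_fderiv_fderiv_luneCoord {k j a b : Fin 4} (h : IsOrder k j a b) (H : ℂ → ℝ) (x : E)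
    (hH : ContDiffAt ℝ 2 H (luneCoord k a b x)) :
    Δ (fun y => H (luneCoord k a b y)) x = Δ H (luneCoord k a b x) := by
  have e := stdOrthonormalBasis ℝ E
  rw [laplacian_eq_sum_fderiv e, laplacian_eq_iteratedFDeriv_complexPlane]
  simp only [iteratedFDeriv_two_apply, fderiv_fderiv_comp_clm (luneCoord k a b) hH]
  set Q := fderiv ℝ (fderiv ℝ H) (luneCoord k a b x)
  set n1 : E := (2 * √2)⁻¹ • (vertex a + vertex b - (2 : ℝ) • vertex k) with hn1
  set n2 : E := (√3 / (2 * √2)) • (vertex a - vertex b) with hn2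
  have hL : ∀ v, luneCoord k a b v = (inner ℝ n1 v : ℝ) • (1 : ℂ) +
      (inner ℝ n2 v : ℝ) • Complex.I := fun v => rfl
  obtain ⟨h1, h2, h3, h4, h5, h6⟩ := h
  have e1 : ((2 * √2)⁻¹) * ((2 * √2)⁻¹) = (1 / 8 : ℝ) := by
    rw [← sq, inv_pow, mul_pow, Real.sq_sqrt (by norm_num)]; norm_num
  have e2 : (√3 / (2 * √2)) * (√3 / (2 * √2)) = (3 / 8 : ℝ) := by
    rw [← sq, div_pow, mul_pow, Real.sq_sqrt (by norm_num), Real.sq_sqrt (by norm_num)]; norm_num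
  have i11 : inner ℝ n1 n1 = (1 : ℝ) := by
    rw [hn1, real_inner_smul_left, real_inner_smul_right, ← mul_assoc, e1]
    simp only [inner_add_left, inner_sub_left, inner_add_right, inner_sub_right,
      real_inner_smul_left, real_inner_smul_right, inner_vertex, h2, h3, h6, h2.symm, h3.symm,
      h6.symm, if_true, if_false]
    norm_num
  have i22 : inner ℝ n2 n2 = (1 : ℝ) := by
    rw [hn2, real_inner_smul_left, real_inner_smul_right, ← mul_assoc, e2]
    simp only [inner_sub_left, inner_sub_right, inner_vertex, h6, h6.symm, if_true, if_false]
    norm_num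
  have i12 : inner ℝ n1 n2 = (0 : ℝ) := by
    rw [hn1, hn2, real_inner_smul_left, real_inner_smul_right]
    simp only [inner_add_left, inner_sub_left, inner_sub_right,
      real_inner_smul_left, inner_vertex, h2, h3, h6,
      h6.symm, if_true, if_false]
    norm_num
  have expand : ∀ v, Q (luneCoord k a b v) (luneCoord k a b v) =
      inner ℝ n1 v * inner ℝ v n1 * Q 1 1 + inner ℝ n1 v * inner ℝ v n2 * (Q 1 Complex.I
        + Q Complex.I 1) + inner ℝ n2 v * inner ℝ v n2 * Q Complex.I Complex.I := by
    intro v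
    rw [hL v, real_inner_comm n1 v, real_inner_comm n2 v]
    simp only [map_add, map_smul, _root_.add_apply, _root_.smul_apply,
      smul_eq_mul]
    ring
  simp only [expand, Finset.sum_add_distrib, ← Finset.sum_mul, e.sum_inner_mul_inner, i11, i22, i12]
  simp

/-- The harmonic function `Re ζ ^ β` of the lune at `p_j`, in the coordinate `ζ` of
`luneCoord k a b`. -/
def lunePow (k a b : Fin 4) (β : ℝ) (x : E) : ℝ := ((luneCoord k a b x) ^ (β : ℂ)).re

/-- `Re ζ ^ β` is harmonic, homogeneous of degree `β`, and constant along the direction `p_j`. -/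
theorem exists_hasGradLap_lunePow {k j a b : Fin 4} (h : IsOrder k j a b) (β : ℝ) {x : E}
    (hx : x ∈ chamber k) : ∃ G : E, HasGradLap (lunePow k a b β) x G 0 ∧
      inner ℝ G x = β * lunePow k a b β x ∧ inner ℝ G (vertex j) = 0 := by
  have hs := luneCoord_mem_slitPlane h hx
  have han : AnalyticAt ℂ (fun z : ℂ => z ^ (β : ℂ)) (luneCoord k a b x) :=
    analyticAt_id.cpow analyticAt_const hs
  have hh := han.harmonicAt_re
  have hc : ContDiffAt ℝ 2 (lunePow k a b β) x :=
    hh.1.comp x (luneCoord k a b).contDiff.contDiffAt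
  have hgl := hasGradLap_of_contDiffAt hc
  have hd : HasFDerivAt (lunePow k a b β) (Complex.reCLM.comp
      (((ContinuousLinearMap.toSpanSingleton ℂ ((β : ℂ) * luneCoord k a b x ^ ((β : ℂ) - 1))
        ).restrictScalars ℝ).comp (luneCoord k a b))) x := by
    have h1 := (Complex.hasStrictDerivAt_cpow_const (c := (β : ℂ)) hs)
      |>.hasDerivAt.hasFDerivAt.restrictScalars ℝ
    exact Complex.reCLM.hasFDerivAt.comp x (h1.comp x (luneCoord k a b).hasFDerivAt)
  have hG : ∀ v, inner ℝ (gradient (lunePow k a b β) x) v =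
      (luneCoord k a b v * ((β : ℂ) * luneCoord k a b x ^ ((β : ℂ) - 1))).re := by
    intro v
    have := congrArg (fun T => T v) (hgl.hasFDerivAt.unique hd)
    simpa using this
  refine ⟨_, hgl.congr_val rfl ?_, ?_, ?_⟩
  · have := sum_fderiv_fderiv_luneCoord h (fun z => (z ^ (β : ℂ)).re) x hh.1
    rw [hh.2.self_of_nhds] at this
    exact this
  · rw [hG x, lunePow]
    have hne := Complex.slitPlane_ne_zero hs
    rw [show luneCoord k a b x * ((β : ℂ) * luneCoord k a b x ^ ((β : ℂ) - 1)) =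
      (β : ℂ) * luneCoord k a b x ^ (β : ℂ) by
        rw [Complex.cpow_sub _ _ hne, Complex.cpow_one]; field_simp]
    rw [Complex.re_ofReal_mul]
  · rw [hG, luneCoord_vertex h]; simp

theorem lunePow_eq (k a b : Fin 4) (β : ℝ) (x : E) : lunePow k a b β x =
    ‖luneCoord k a b x‖ ^ β * Real.cos ((luneCoord k a b x).arg * β) :=
  Complex.cpow_ofReal_re _ _

theorem lunePow_le (k a b : Fin 4) (β : ℝ) (x : E) :
    lunePow k a b β x ≤ ‖luneCoord k a b x‖ ^ β := by
  rw [lunePow_eq]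
  exact mul_le_of_le_one_right (by positivity) (Real.cos_le_one _)

theorem cos_mul_le_lunePow {k j a b : Fin 4} (h : IsOrder k j a b) {β : ℝ} (hβ : |β| ≤ 3 / 2)
    {x : E} (hx : x ∈ chamber k) :
    Real.cos (Real.pi / 3 * |β|) * ‖luneCoord k a b x‖ ^ β ≤ lunePow k a b β x := by
  rw [lunePow_eq, mul_comm]
  refine mul_le_mul_of_nonneg_left ?_ (by positivity)
  rw [← Real.cos_abs (_ * β), abs_mul]
  refine Real.cos_le_cos_of_nonneg_of_le_pi (by positivity) ?_
    (mul_le_mul_of_nonneg_right (abs_arg_luneCoord_le h hx) (abs_nonneg _))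
  nlinarith [Real.pi_pos, abs_nonneg β]

theorem cos_pi_div_three_mul_nonneg {β : ℝ} (hβ : |β| ≤ 3 / 2) :
    0 ≤ Real.cos (Real.pi / 3 * |β|) :=
  Real.cos_nonneg_of_neg_pi_div_two_le_of_le (by nlinarith [Real.pi_pos, abs_nonneg β])
    (by nlinarith [Real.pi_pos, abs_nonneg β])

theorem cos_pi_div_three_mul_pos {β : ℝ} (hβ : |β| < 3 / 2) :
    0 < Real.cos (Real.pi / 3 * |β|) :=
  Real.cos_pos_of_mem_Ioo ⟨by nlinarith [Real.pi_pos, abs_nonneg β],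
    by nlinarith [Real.pi_pos, abs_nonneg β]⟩

theorem lunePow_nonneg {k j a b : Fin 4} (h : IsOrder k j a b) {β : ℝ} (hβ : |β| ≤ 3 / 2)
    {x : E} (hx : x ∈ chamber k) : 0 ≤ lunePow k a b β x :=
  (mul_nonneg (cos_pi_div_three_mul_nonneg hβ) (by positivity)).trans (cos_mul_le_lunePow h hβ hx)

/-- In the sector `|arg ζ| ≤ π / 3` and for `|ζ| ≤ 1`, the function `Re ζ ^ (3/2)` controls the
quadratic harmonic polynomial that vanishes on the two sides of the sector. -/
theorem height_mul_height_le_lunePow {k j a b : Fin 4} (h : IsOrder k j a b) {x : E}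
    (hx : x ∈ chamber k) (h1 : ‖luneCoord k a b x‖ ≤ 1) :
    9 / 4 * ((height a x - height k x) * (height b x - height k x)) ≤
      9 / 2 * lunePow k a b (3 / 2) x := by
  set ζ := luneCoord k a b x with hζ
  set φ := ζ.arg / 2 with hφ
  set c := Real.cos φ with hc
  have hs := norm_luneCoord_pos h hx
  have harg := abs_le.1 (abs_arg_luneCoord_le h hx)
  have hre : ζ.re = ‖ζ‖ * (2 * c ^ 2 - 1) := by
    rw [hc, ← Real.cos_two_mul, hφ, mul_div_cancel₀ _ two_ne_zero, Complex.norm_mul_cos_arg]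
  have hn : ‖ζ‖ ^ 2 = ζ.re ^ 2 + ζ.im ^ 2 := by
    rw [Complex.sq_norm, Complex.normSq_apply, sq, sq]
  have hAB : 3 / 2 * ((height a x - height k x) * (height b x - height k x)) =
      ‖ζ‖ ^ 2 * ((4 * c ^ 2 - 3) * (4 * c ^ 2 - 1)) := by
    have e1 : ((2 * √2)⁻¹) ^ 2 = (1 / 8 : ℝ) := by
      rw [inv_pow, mul_pow, Real.sq_sqrt (by norm_num)]; norm_num
    have e2 : (√3 / (2 * √2)) ^ 2 = (3 / 8 : ℝ) := by
      rw [div_pow, mul_pow, Real.sq_sqrt (by norm_num), Real.sq_sqrt (by norm_num)]; norm_num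
    have : 3 * ζ.re ^ 2 - ζ.im ^ 2 =
        3 / 2 * ((height a x - height k x) * (height b x - height k x)) := by
      rw [hζ, luneCoord_re, luneCoord_im, mul_pow, mul_pow, e1, e2]; ring
    rw [← this, show ζ.im ^ 2 = ‖ζ‖ ^ 2 - ζ.re ^ 2 by linarith, hre]
    ring
  have hW : lunePow k a b (3 / 2) x = ‖ζ‖ ^ (3 / 2 : ℝ) * (c * (4 * c ^ 2 - 3)) := by
    rw [lunePow_eq, ← hζ, show ζ.arg * (3 / 2) = 3 * φ by rw [hφ]; ring, Real.cos_three_mul, hc]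
    ring
  have hc0 : Real.cos (Real.pi / 6) ≤ c := by
    rw [hc, ← Real.cos_abs φ]
    refine Real.cos_le_cos_of_nonneg_of_le_pi (abs_nonneg _) (by linarith [Real.pi_pos]) ?_
    rw [abs_le]; constructor <;> linarith
  rw [Real.cos_pi_div_six] at hc0
  have hc1 : c ≤ 1 := Real.cos_le_one _
  have h3 : (√3) ^ 2 = 3 := Real.sq_sqrt (by norm_num)
  have hcpos : 0 < c := lt_of_lt_of_le (by positivity) hc0
  have hcc : 0 ≤ 4 * c ^ 2 - 3 := by nlinarith [Real.sqrt_nonneg 3]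
  have hpow : ‖ζ‖ ^ 2 ≤ ‖ζ‖ ^ (3 / 2 : ℝ) := by
    rw [← Real.rpow_natCast]
    exact Real.rpow_le_rpow_of_exponent_ge hs h1 (by norm_num)
  have hlin : 4 * c ^ 2 - 1 ≤ 3 * c := by nlinarith
  have s1 : ‖ζ‖ ^ 2 * ((4 * c ^ 2 - 3) * (4 * c ^ 2 - 1)) ≤
      ‖ζ‖ ^ (3 / 2 : ℝ) * ((4 * c ^ 2 - 3) * (3 * c)) :=
    mul_le_mul hpow (mul_le_mul_of_nonneg_left hlin hcc) (mul_nonneg hcc (by linarith))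
      (by positivity)
  rw [hW]
  linarith

/-! ### Comparison in a chamber -/

/-- A positive harmonic function on the chamber `C_k` that tends to infinity at its three
rays. -/
def rayPole (k a b c : Fin 4) (x : E) : ℝ :=
  lunePow k b c (-(3 / 4)) x + lunePow k c a (-(3 / 4)) x + lunePow k a b (-(3 / 4)) x

theorem rayPole_rotate (k a b c : Fin 4) (x : E) : rayPole k b c a x = rayPole k a b c x := by
  simp only [rayPole]; ring

theorem exists_hasGradLap_rayPole {k a b c : Fin 4} (h : IsOrder k a b c) {x : E}
    (hx : x ∈ chamber k) : ∃ G, HasGradLap (rayPole k a b c) x G 0 := by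
  obtain ⟨G1, h1, -⟩ := exists_hasGradLap_lunePow h (-(3 / 4)) hx
  obtain ⟨G2, h2, -⟩ := exists_hasGradLap_lunePow h.rotate (-(3 / 4)) hx
  obtain ⟨G3, h3, -⟩ := exists_hasGradLap_lunePow h.rotate.rotate (-(3 / 4)) hx
  exact ⟨_, ((h1.add h2).add h3).congr_val rfl (by simp)⟩

theorem le_rayPole {k a b c : Fin 4} (h : IsOrder k a b c) {x : E} (hx : x ∈ chamber k) :
    1 / 2 * ‖luneCoord k b c x‖ ^ (-(3 / 4) : ℝ) ≤ rayPole k a b c x := by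
  have hβ : |(-(3 / 4) : ℝ)| = 3 / 4 := by rw [abs_neg, abs_of_pos (by norm_num)]
  have hβ' : |(-(3 / 4) : ℝ)| ≤ 3 / 2 := by rw [hβ]; norm_num
  have h1 := cos_mul_le_lunePow h hβ' hx
  have h2 := lunePow_nonneg h.rotate hβ' hx
  have h3 := lunePow_nonneg h.rotate.rotate hβ' hx
  have h4 : (1 / 2 : ℝ) ≤ Real.cos (Real.pi / 3 * |(-(3 / 4) : ℝ)|) := by
    rw [← Real.cos_pi_div_three, hβ]
    exact Real.cos_le_cos_of_nonneg_of_le_pi (by positivity) (by linarith [Real.pi_pos])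
      (by linarith [Real.pi_pos])
  have h5 := mul_le_mul_of_nonneg_right h4
    (Real.rpow_nonneg (norm_nonneg (luneCoord k b c x)) (-(3 / 4)))
  unfold rayPole
  linarith

theorem norm_rpow_le_rayPole {k a b c : Fin 4} (h : IsOrder k a b c) {x : E} (hx : x ∈ chamber k) :
    1 / 2 * ‖x‖ ^ (-(3 / 4) : ℝ) ≤ rayPole k a b c x :=
  (mul_le_mul_of_nonneg_left (Real.rpow_le_rpow_of_nonpos (norm_luneCoord_pos h hx)
    (norm_luneCoord_le h x) (by norm_num)) (by norm_num)).trans (le_rayPole h hx)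

theorem rayPole_nonneg {k a b c : Fin 4} (h : IsOrder k a b c) {x : E} (hx : x ∈ chamber k) :
    0 ≤ rayPole k a b c x :=
  le_trans (by positivity) (norm_rpow_le_rayPole h hx)

theorem eventually_lt_rayPole {k a b c : Fin 4} (h : IsOrder k a b c) {j : Fin 4} (hj : j ≠ k)
    {p : E} (hp : p ∈ ray j) (N : ℝ) : ∀ᶠ x in 𝓝[chamber k] p, N < rayPole k a b c x := by
  -- The three rays are interchangeable, by a rotation of `a, b, c`.
  have key : ∀ {a b c : Fin 4}, IsOrder k a b c → p ∈ ray a →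
      ∀ᶠ x in 𝓝[chamber k] p, N < rayPole k a b c x := by
    intro a b c h hp
    have h0 : Tendsto (fun x => ‖luneCoord k b c x‖) (𝓝[chamber k] p) (𝓝[>] 0) := by
      refine tendsto_nhdsWithin_iff.2 ⟨?_, ?_⟩
      · have : Continuous fun x => ‖luneCoord k b c x‖ := by fun_prop
        have := (this.tendsto p).mono_left (nhdsWithin_le_nhds (s := chamber k))
        simpa [luneCoord_ray h hp] using this
      · filter_upwards [self_mem_nhdsWithin] with x hx using norm_luneCoord_pos h hx
    have h1 := (tendsto_rpow_neg_nhdsGT_zero (y := (-(3 / 4) : ℝ)) (by norm_num)).comp h0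
    filter_upwards [h1.eventually_gt_atTop (2 * N), self_mem_nhdsWithin] with x hx hxc
    have := le_rayPole h hxc
    simp only [Function.comp] at hx
    linarith
  rcases h.eq_or j with rfl | rfl | rfl | rfl
  · exact absurd rfl hj
  · exact key h hp
  · simpa only [rayPole_rotate] using key h.rotate hp
  · simpa only [← rayPole_rotate] using key h.rotate.rotate hp

/-- Comparison of a function `V`, subharmonic where it is positive and vanishing on the walls, with
a nonnegative superharmonic function `S` on a part of a chamber.  Along the rays `V` need only be
negligible with respect to `rayPole`. -/
theorem le_of_superharmonic {k a b c : Fin 4} (h : IsOrder k a b c) {O : Set E} (hO : IsOpen O)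
    (hOb : Bornology.IsBounded O) {V S : E → ℝ}
    (hV : ∀ x ∈ chamber k ∩ O, ContDiffAt ℝ 2 V x)
    (hsub : ∀ x ∈ chamber k ∩ O, 0 < V x → 0 ≤ Δ V x)
    (hS : ∀ x ∈ chamber k ∩ O, ContDiffAt ℝ 2 S x ∧ Δ S x ≤ 0 ∧ 0 ≤ S x)
    (hwall : ∀ i, i ≠ k → ∀ p ∈ openWall k i ∩ O, ∀ ε > 0, ∀ᶠ x in 𝓝[chamber k] p, V x < ε)
    (hray : ∀ j, j ≠ k → ∀ p ∈ ray j ∩ O, ∀ η > 0,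
      ∀ᶠ x in 𝓝[chamber k] p, V x < η * rayPole k a b c x)
    (hout : ∀ p ∈ closure O, p ∉ O → ∀ ε > 0, ∀ᶠ x in 𝓝[chamber k ∩ O] p, V x - S x < ε) :
    ∀ x ∈ chamber k ∩ O, V x ≤ S x := by
  have key : ∀ η > 0, ∀ x ∈ chamber k ∩ O, V x - S x - η * rayPole k a b c x ≤ 0 := by
    intro η hη
    have hgl : ∀ x ∈ chamber k ∩ O, ContDiffAt ℝ 2 (fun x => V x - S x - η * rayPole k a b c x) x ∧
        Δ (fun x => V x - S x - η * rayPole k a b c x) x = Δ V x - Δ S x := by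
      intro x hx
      obtain ⟨G, hG⟩ := exists_hasGradLap_rayPole h hx.1
      have := ((hasGradLap_of_contDiffAt (hV x hx)).sub (hasGradLap_of_contDiffAt (hS x hx).1)).sub
        (hG.const_mul η)
      exact ⟨this.contDiffAt, by rw [this.laplacian_eq]; ring⟩
    refine nonpos_of_subharmonic ((isOpen_chamber k).inter hO) (hOb.subset inter_subset_right)
      (by simp) (fun x hx => (hgl x hx).1) (fun x hx hpos => ?_) fun p hp hpn ε hε => ?_
    · have h1 := rayPole_nonneg h hx.1
      have h2 := mul_nonneg hη.le h1
      rw [(hgl x hx).2]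
      have := hsub x hx (by linarith [(hS x hx).2.2])
      linarith [(hS x hx).2.1]
    · have hle : ∀ x ∈ chamber k ∩ O, V x - S x - η * rayPole k a b c x ≤ V x - S x :=
        fun x hx => sub_le_self _ (mul_nonneg hη.le (rayPole_nonneg h hx.1))
      by_cases hpO : p ∈ O
      · have hcl := closure_mono (inter_subset_left (s := chamber k) (t := O)) hp
        have hmono : 𝓝[chamber k ∩ O] p ≤ 𝓝[chamber k] p := nhdsWithin_mono _ inter_subset_left
        rcases mem_openWall_or_ray (height_le_of_mem_closure_chamber hcl)
          (fun hc => hpn ⟨hc, hpO⟩) with ⟨i, hi, hw⟩ | ⟨j, hj, hr⟩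
        · filter_upwards [hmono (hwall i hi p ⟨hw, hpO⟩ ε hε), self_mem_nhdsWithin] with x hx hxD
          have := hle x hxD
          linarith [(hS x hxD).2.2]
        · filter_upwards [hmono (hray j hj p ⟨hr, hpO⟩ η hη), self_mem_nhdsWithin] with x hx hxD
          linarith [(hS x hxD).2.2]
      · have hcl := closure_mono (inter_subset_right (s := chamber k) (t := O)) hp
        filter_upwards [hout p hcl hpO ε hε, self_mem_nhdsWithin] with x hx hxD
        exact (hle x hxD).trans_lt hx
  intro x hx
  have h1 := rayPole_nonneg h hx.1
  refine le_of_forall_pos_le_add fun ε hε => ?_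
  have := key (ε / (rayPole k a b c x + 1)) (by positivity) x hx
  have h2 : ε / (rayPole k a b c x + 1) * rayPole k a b c x ≤ ε := by
    rw [div_mul_eq_mul_div, div_le_iff₀ (by positivity)]; nlinarith
  linarith

/-! ### The decay at a ray -/

/-- A bounded function on a chamber that is subharmonic where it is positive and vanishes on the
walls is bounded by the `3/2`-th power of the distance to the axis of each ray of the chamber. -/
theorem le_luneCoord_rpow {k j a b : Fin 4} (h : IsOrder k j a b) {V : E → ℝ} {M r₀ r₁ : ℝ}
    (hM : 0 ≤ M) (hr : r₀ < r₁) (hr₁ : r₁ ≤ 1)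
    (hV : ∀ x ∈ chamber k ∩ Metric.ball 0 r₁, ContDiffAt ℝ 2 V x)
    (hsub : ∀ x ∈ chamber k ∩ Metric.ball 0 r₁, 0 < V x → 0 ≤ Δ V x)
    (hwall : ∀ i, i ≠ k → ∀ p ∈ openWall k i ∩ Metric.ball 0 r₁, ∀ ε > 0,
      ∀ᶠ x in 𝓝[chamber k] p, V x < ε)
    (hb : ∀ x ∈ chamber k ∩ Metric.ball 0 r₁, V x ≤ M) {x : E} (hx : x ∈ chamber k)
    (hxr : ‖x‖ ≤ r₀) :
    V x ≤ 6 * M / (r₁ - r₀) ^ 2 * ‖luneCoord k a b x‖ ^ (3 / 2 : ℝ) := by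
  set δ := r₁ - r₀ with hδ
  have hδ0 : 0 < δ := sub_pos.2 hr
  set s := ‖luneCoord k a b x‖ with hs
  have hspos : 0 < s := norm_luneCoord_pos h hx
  have hδ1 : δ ≤ 1 := by linarith [norm_nonneg x]
  have hsx : s ≤ ‖x‖ := norm_luneCoord_le h x
  by_cases hsδ : δ ≤ s
  · refine (hb x ⟨hx, by rw [mem_ball_zero_iff]; linarith⟩).trans ?_
    have h1 : s ^ 2 ≤ s ^ (3 / 2 : ℝ) := by
      rw [← Real.rpow_natCast]
      exact Real.rpow_le_rpow_of_exponent_ge hspos (by linarith) (by norm_num)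
    have h2 : δ ^ 2 ≤ s ^ (3 / 2 : ℝ) := (pow_le_pow_left₀ hδ0.le hsδ 2).trans h1
    rw [div_mul_eq_mul_div, le_div_iff₀ (by positivity)]
    nlinarith [mul_le_mul_of_nonneg_left h2 hM, mul_nonneg hM (sq_nonneg δ)]
  push Not at hsδ
  set q : E := height j x • vertex j with hq
  have hxq : ‖x - q‖ ^ 2 = s ^ 2 := by
    rw [hs, norm_sq_luneCoord h, hq, norm_sub_sq_real, norm_smul, norm_vertex, mul_one,
      real_inner_smul_right, real_inner_comm]
    change ‖x‖ ^ 2 - 2 * (height j x * height j x) + ‖height j x‖ ^ 2 = _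
    rw [Real.norm_eq_abs, sq_abs]; ring
  have hqn : ‖q‖ ≤ r₀ := by
    rw [hq, norm_smul, norm_vertex, mul_one]
    refine le_trans ?_ hxr
    have := norm_inner_le_norm (𝕜 := ℝ) (vertex j) x
    rwa [norm_vertex, one_mul] at this
  have hball : Metric.ball q δ ⊆ Metric.ball 0 r₁ := by
    intro y hy
    rw [mem_ball_zero_iff]
    rw [mem_ball_iff_norm] at hy
    have := norm_add_le (y - q) q
    rw [sub_add_cancel] at this
    linarith
  -- The harmonic comparison function on the ball around `q`; the term with `lunePow` outweighs the
  -- product of the two forms that vanish on the faces, so `R y` is at least `‖y - q‖ ^ 2`.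
  set R : E → ℝ := fun y => (‖y‖ ^ 2 - 2 * inner ℝ q y + ‖q‖ ^ 2) + 9 / 2 * lunePow k a b (3 / 2) y
    - 9 / 4 * (inner ℝ (vertex a - vertex k) y * inner ℝ (vertex b - vertex k) y) with hR
  have hRh : ∀ y : E, inner ℝ (vertex a - vertex k) y * inner ℝ (vertex b - vertex k) y =
      (height a y - height k y) * (height b y - height k y) := fun y => by
    rw [inner_sub_left, inner_sub_left]; rfl
  have hRq : ∀ y : E, ‖y‖ ^ 2 - 2 * inner ℝ q y + ‖q‖ ^ 2 = ‖y - q‖ ^ 2 := fun y => by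
    rw [norm_sub_sq_real, real_inner_comm]
  have hRle : ∀ y ∈ chamber k ∩ Metric.ball q δ, ‖y - q‖ ^ 2 ≤ R y := by
    intro y hy
    have h1 := mem_ball_zero_iff.1 (hball hy.2)
    have h2 := height_mul_height_le_lunePow h hy.1 (by linarith [norm_luneCoord_le h y])
    simp only [hR, hRq, hRh]
    linarith
  have hRharm : ∀ y ∈ chamber k, ∃ G, HasGradLap R y G 0 := by
    intro y hy
    obtain ⟨G, hG, -⟩ := exists_hasGradLap_lunePow h (3 / 2) hy
    have := (((((hasGradLap_norm_sq y).sub ((hasGradLap_inner q y).const_mul 2)).add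
      (hasGradLap_const (‖q‖ ^ 2) y)).add (hG.const_mul (9 / 2)))).sub
      (((hasGradLap_inner (vertex a - vertex k) y).mul
        (hasGradLap_inner (vertex b - vertex k) y)).const_mul (9 / 4))
    refine ⟨_, this.congr_val rfl ?_⟩
    obtain ⟨h1, h2, h3, h4, h5, h6⟩ := h
    simp only [inner_sub_left, inner_sub_right, inner_vertex, h2.symm, h3, h6, if_true,
      if_false, finrank_euclideanSpace_fin]
    norm_num
  have hδ2 : 0 < δ ^ 2 := by positivity
  have hcomp := le_of_superharmonic h (O := Metric.ball q δ) Metric.isOpen_ball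
    Metric.isBounded_ball (V := V) (S := fun y => M / δ ^ 2 * R y)
    (fun y hy => hV y ⟨hy.1, hball hy.2⟩) (fun y hy => hsub y ⟨hy.1, hball hy.2⟩)
    (fun y hy => by
      obtain ⟨G, hG⟩ := hRharm y hy.1
      have h1 := hG.const_mul (M / δ ^ 2)
      refine ⟨h1.contDiffAt, by rw [h1.laplacian_eq]; simp, ?_⟩
      have := (sq_nonneg _).trans (hRle y hy)
      positivity)
    (fun i hi p hp => hwall i hi p ⟨hp.1, hball hp.2⟩)
    (fun i hi p hp η hη => by
      have hb' : ∀ᶠ y in 𝓝[chamber k] p, y ∈ Metric.ball q δ :=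
        nhdsWithin_le_nhds (Metric.isOpen_ball.mem_nhds hp.2)
      filter_upwards [eventually_lt_rayPole h hi hp.1 (M / η), hb', self_mem_nhdsWithin]
        with y hy hyb hyc
      rw [div_lt_iff₀' hη] at hy
      exact (hb y ⟨hyc, hball hyb⟩).trans_lt hy)
    (fun p hp hpn ε hε => by
      have hpq : δ ≤ ‖p - q‖ := by
        rw [mem_ball_iff_norm, not_lt] at hpn; exact hpn
      have hct : ContinuousAt (fun y : E => M - M / δ ^ 2 * ‖y - q‖ ^ 2) p := by fun_prop
      have hlt : M - M / δ ^ 2 * ‖p - q‖ ^ 2 < ε := by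
        have h1 := pow_le_pow_left₀ hδ0.le hpq 2
        have h2 : M / δ ^ 2 * δ ^ 2 ≤ M / δ ^ 2 * ‖p - q‖ ^ 2 :=
          mul_le_mul_of_nonneg_left h1 (by positivity)
        rw [div_mul_cancel₀ _ hδ2.ne'] at h2
        linarith
      filter_upwards [nhdsWithin_le_nhds (hct.eventually_lt continuousAt_const hlt),
        self_mem_nhdsWithin] with y hy hyD
      have h1 := hb y ⟨hyD.1, hball hyD.2⟩
      have h2 := mul_le_mul_of_nonneg_left (hRle y hyD) (by positivity : 0 ≤ M / δ ^ 2)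
      linarith)
  have hxball : x ∈ Metric.ball q δ := by
    rw [mem_ball_iff_norm]
    exact lt_of_pow_lt_pow_left₀ 2 hδ0.le (by
      rw [hxq]; exact pow_lt_pow_left₀ hsδ hspos.le two_ne_zero)
  have hfin := hcomp x ⟨hx, hxball⟩
  have hRx : R x ≤ 6 * s ^ (3 / 2 : ℝ) := by
    have h1 : s ^ 2 ≤ s ^ (3 / 2 : ℝ) := by
      rw [← Real.rpow_natCast]
      exact Real.rpow_le_rpow_of_exponent_ge hspos (by linarith) (by norm_num)
    have h2 := lunePow_le k a b (3 / 2) x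
    have h3 := h.mem_chamber_iff.1 hx
    have h4 := mul_pos (sub_pos.2 h3.2.1) (sub_pos.2 h3.2.2)
    simp only [hR, hRq, hRh, hxq]
    have h5 : 0 ≤ s ^ (3 / 2 : ℝ) := by positivity
    linarith
  calc V x ≤ M / δ ^ 2 * R x := hfin
    _ ≤ M / δ ^ 2 * (6 * s ^ (3 / 2 : ℝ)) := mul_le_mul_of_nonneg_left hRx (by positivity)
    _ = _ := by ring

/-! ### A superharmonic function of degree above `3/2` -/

/-- The chamber `C_k` stays away from the antipodes of its vertices. -/
theorem neg_norm_le_height {k j a b : Fin 4} (h : IsOrder k j a b) {x : E} (hx : x ∈ chamber k) :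
    -(3 / 5) * ‖x‖ ≤ height j x := by
  obtain ⟨hj, ha, hb⟩ := h.mem_chamber_iff.1 hx
  have h1 := h.height_sum x
  have h2 := h.height_sq_sum x
  by_contra! hlt
  have hneg : height j x < 0 := lt_of_lt_of_le hlt (by nlinarith [norm_nonneg x])
  have hsq : 9 / 25 * ‖x‖ ^ 2 < height j x ^ 2 := by nlinarith [norm_nonneg x]
  have h3 : height b x = -(height k x + height j x + height a x) := by linarith
  rw [h3] at h2 hb
  nlinarith [mul_pos (sub_pos.2 hj) (neg_pos.2 hneg), sq_nonneg (height k x + height j x +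
    2 * height a x), sq_nonneg (height k x - height j x)]

theorem height_le_norm (j : Fin 4) (x : E) : height j x ≤ ‖x‖ := by
  have := real_inner_le_norm (vertex j) x
  rwa [norm_vertex, one_mul] at this

theorem hasGradLap_norm_div_add_height {j : Fin 4} {x : E} (hx : x ≠ 0)
    (ht : ‖x‖ + height j x ≠ 0) :
    HasGradLap (fun y => ‖y‖ * (‖y‖ + height j y)⁻¹) x
      ((height j x / (‖x‖ * (‖x‖ + height j x) ^ 2)) • x -
        (‖x‖ / (‖x‖ + height j x) ^ 2) • vertex j) (2 / (‖x‖ + height j x) ^ 2) := by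
  have hr : ‖x‖ ≠ 0 := norm_ne_zero_iff.2 hx
  have h1 := hasGradLap_norm hx
  have h2 : HasGradLap (height j) x (vertex j) 0 := hasGradLap_inner (vertex j) x
  have hip : inner ℝ x (vertex j) = height j x := real_inner_comm _ _
  have hpi : inner ℝ (vertex j) x = height j x := rfl
  have hn : ‖‖x‖⁻¹ • x + vertex j‖ ^ 2 = 2 * (‖x‖ + height j x) / ‖x‖ := by
    rw [norm_add_sq_real, norm_smul, norm_vertex, real_inner_smul_left, hip, norm_inv, norm_norm]
    field_simp; ring
  refine (h1.mul ((h1.add h2).inv ht)).congr_val ?_ ?_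
  · rw [smul_smul, smul_add, smul_smul, smul_smul, add_right_comm, ← add_smul, sub_eq_add_neg,
      ← neg_smul]
    congr 2
    · field_simp; ring
    · field_simp
  · rw [hn, finrank_euclideanSpace_fin]
    simp only [real_inner_smul_left, real_inner_smul_right, inner_add_right,
      real_inner_self_eq_norm_sq, hip, norm_smul, norm_inv, norm_norm, inv_mul_cancel₀ hr]
    push_cast
    field_simp
    ring

/-- The barrier `Re ζ ^ (7/5) · r ^ (1/8) · (13/5 - r / (r + z))` of the lune at `p_j`, with `z` the
height over `p_j`.  It is homogeneous of degree `61/40`. -/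
def luneBarrier (k j a b : Fin 4) (x : E) : ℝ :=
  lunePow k a b (7 / 5) x *
    (‖x‖ ^ (1 / 8 : ℝ) * (13 / 5 - ‖x‖ * (‖x‖ + height j x)⁻¹))

theorem norm_div_add_height_le {k j a b : Fin 4} (h : IsOrder k j a b) {x : E}
    (hx : x ∈ chamber k) : 1 / 2 ≤ ‖x‖ * (‖x‖ + height j x)⁻¹ ∧
      ‖x‖ * (‖x‖ + height j x)⁻¹ ≤ 5 / 2 ∧ 0 < ‖x‖ + height j x := by
  have h1 := neg_norm_le_height h hx
  have h2 := height_le_norm j x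
  have h3 : 0 < ‖x‖ := norm_pos_iff.2 (ne_zero_of_mem_chamber hx)
  have h4 : 0 < ‖x‖ + height j x := by linarith
  rw [← div_eq_mul_inv, le_div_iff₀ h4, div_le_iff₀ h4]
  exact ⟨by linarith, by linarith, h4⟩

/-- `luneBarrier` is superharmonic on the chamber.  With `ρ = r / (r + z)`, which lies in
`[1/2, 5/2]` there, its Laplacian is `Re ζ ^ (7/5) · r ^ (1/8 - 2)` times a convex quadratic
polynomial in `ρ` that is negative at both ends of this interval. -/
theorem exists_hasGradLap_luneBarrier {k j a b : Fin 4} (h : IsOrder k j a b) {x : E}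
    (hx : x ∈ chamber k) : ∃ G l, HasGradLap (luneBarrier k j a b) x G l ∧ l ≤ 0 := by
  have hx0 := ne_zero_of_mem_chamber hx
  have hr : 0 < ‖x‖ := norm_pos_iff.2 hx0
  obtain ⟨hρ1, hρ2, ht⟩ := norm_div_add_height_le h hx
  obtain ⟨G, hG, hGx, hGp⟩ := exists_hasGradLap_lunePow h (7 / 5) hx
  have hW := lunePow_nonneg h (β := 7 / 5) (by rw [abs_of_pos] <;> norm_num) hx
  have hq := (hasGradLap_norm hx0).rpow hr (1 / 8)
  have hm := (hasGradLap_const (13 / 5) x).sub (hasGradLap_norm_div_add_height hx0 ht.ne')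
  refine ⟨_, _, hG.mul (hq.mul hm), ?_⟩
  have hip : inner ℝ x (vertex j) = height j x := real_inner_comm _ _
  simp only [finrank_euclideanSpace_fin, real_inner_smul_left, real_inner_smul_right,
    inner_add_right, inner_sub_right, inner_zero_right, hGx, hGp, hip, real_inner_self_eq_norm_sq,
    norm_smul, norm_inv, norm_norm]
  rw [Real.rpow_sub_one hr.ne', Real.rpow_sub hr _ 2, Real.rpow_ofNat]
  have hP : 0 < ‖x‖ ^ (1 / 8 : ℝ) := by positivity
  set P := ‖x‖ ^ (1 / 8 : ℝ)
  set W := lunePow k a b (7 / 5) x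
  set ρ := ‖x‖ * (‖x‖ + height j x)⁻¹ with hρ
  have hquad : 4 / 5 * ρ ^ 2 - 1053 / 320 * ρ + 2041 / 1600 ≤ 0 := by nlinarith
  have hle : W * P / ‖x‖ ^ 2 * (4 / 5 * ρ ^ 2 - 1053 / 320 * ρ + 2041 / 1600) ≤ 0 :=
    mul_nonpos_of_nonneg_of_nonpos (by positivity) hquad
  refine le_of_eq_of_le ?_ hle
  have hz : height j x = ‖x‖ * ρ⁻¹ - ‖x‖ := by rw [hρ]; field_simp; ring
  have hρ0 : 0 < ρ := by linarith
  rw [hz]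
  push_cast
  field_simp
  ring

theorem le_luneBarrier {k j a b : Fin 4} (h : IsOrder k j a b) {x : E} (hx : x ∈ chamber k) :
    1 / 10 * (lunePow k a b (7 / 5) x * ‖x‖ ^ (1 / 8 : ℝ)) ≤ luneBarrier k j a b x := by
  obtain ⟨hρ1, hρ2, ht⟩ := norm_div_add_height_le h hx
  have hW := lunePow_nonneg h (β := 7 / 5) (by rw [abs_of_pos] <;> norm_num) hx
  have := mul_le_mul_of_nonneg_left (by linarith :
    (1 / 10 : ℝ) ≤ 13 / 5 - ‖x‖ * (‖x‖ + height j x)⁻¹)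
    (mul_nonneg hW (by positivity : 0 ≤ ‖x‖ ^ (1 / 8 : ℝ)))
  unfold luneBarrier
  linarith

theorem luneBarrier_nonneg {k j a b : Fin 4} (h : IsOrder k j a b) {x : E} (hx : x ∈ chamber k) :
    0 ≤ luneBarrier k j a b x := by
  have hW := lunePow_nonneg h (β := 7 / 5) (by rw [abs_of_pos] <;> norm_num) hx
  exact le_trans (by positivity) (le_luneBarrier h hx)

/-- The sum of the barriers of the three lunes that meet in the chamber `C_k`. -/
def chamberBarrier (k a b c : Fin 4) (x : E) : ℝ :=
  luneBarrier k a b c x + luneBarrier k b c a x + luneBarrier k c a b x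

theorem exists_hasGradLap_chamberBarrier {k a b c : Fin 4} (h : IsOrder k a b c) {x : E}
    (hx : x ∈ chamber k) : ∃ G l, HasGradLap (chamberBarrier k a b c) x G l ∧ l ≤ 0 := by
  obtain ⟨G1, l1, h1, n1⟩ := exists_hasGradLap_luneBarrier h hx
  obtain ⟨G2, l2, h2, n2⟩ := exists_hasGradLap_luneBarrier h.rotate hx
  obtain ⟨G3, l3, h3, n3⟩ := exists_hasGradLap_luneBarrier h.rotate.rotate hx
  exact ⟨_, _, (h1.add h2).add h3, by linarith⟩

theorem exists_le_chamberBarrier : ∃ c₀ > 0, ∀ {k a b c : Fin 4}, IsOrder k a b c →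
    ∀ x ∈ chamber k, c₀ * ‖x‖ ^ (61 / 40 : ℝ) ≤ chamberBarrier k a b c x := by
  have hβ : |(7 / 5 : ℝ)| < 3 / 2 := by rw [abs_of_pos] <;> norm_num
  have hcos := cos_pi_div_three_mul_pos hβ
  set κ := Real.cos (Real.pi / 3 * |(7 / 5 : ℝ)|)
  refine ⟨1 / 10 * (κ * (1 / 2) ^ (7 / 5 : ℝ)), by positivity, ?_⟩
  intro k a b c h x hx
  have hr : 0 < ‖x‖ := norm_pos_iff.2 (ne_zero_of_mem_chamber hx)
  -- A lune whose axis is far from `x` has a large barrier.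
  have key : ∀ {a b c : Fin 4}, IsOrder k a b c → ‖x‖ / 2 ≤ ‖luneCoord k b c x‖ →
      1 / 10 * (κ * (1 / 2) ^ (7 / 5 : ℝ)) * ‖x‖ ^ (61 / 40 : ℝ) ≤ luneBarrier k a b c x := by
    intro a b c h hle
    refine le_trans ?_ (le_luneBarrier h hx)
    have h1 := cos_mul_le_lunePow h hβ.le hx
    have h2 : (1 / 2) ^ (7 / 5 : ℝ) * ‖x‖ ^ (7 / 5 : ℝ) ≤ ‖luneCoord k b c x‖ ^ (7 / 5 : ℝ) := by
      rw [← Real.mul_rpow (by norm_num) hr.le]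
      exact Real.rpow_le_rpow (by positivity) (by linarith) (by norm_num)
    have h3 : ‖x‖ ^ (61 / 40 : ℝ) = ‖x‖ ^ (7 / 5 : ℝ) * ‖x‖ ^ (1 / 8 : ℝ) := by
      rw [← Real.rpow_add hr]; norm_num
    have h4 := (mul_le_mul_of_nonneg_left h2 hcos.le).trans h1
    have h5 := mul_le_mul_of_nonneg_right h4 (by positivity : 0 ≤ ‖x‖ ^ (1 / 8 : ℝ))
    rw [h3]
    linarith
  have n1 := luneBarrier_nonneg h hx
  have n2 := luneBarrier_nonneg h.rotate hx
  have n3 := luneBarrier_nonneg h.rotate.rotate hx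
  have s1 := norm_sq_luneCoord h x
  have s2 := norm_sq_luneCoord h.rotate x
  have s3 := norm_sq_luneCoord h.rotate.rotate x
  have hs := h.height_sq_sum x
  unfold chamberBarrier
  by_cases c1 : ‖x‖ / 2 ≤ ‖luneCoord k b c x‖
  · linarith [key h c1]
  by_cases c2 : ‖x‖ / 2 ≤ ‖luneCoord k c a x‖
  · linarith [key h.rotate c2]
  by_cases c3 : ‖x‖ / 2 ≤ ‖luneCoord k a b x‖
  · linarith [key h.rotate.rotate c3]
  exfalso
  push Not at c1 c2 c3
  have q1 := pow_lt_pow_left₀ c1 (norm_nonneg _) two_ne_zero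
  have q2 := pow_lt_pow_left₀ c2 (norm_nonneg _) two_ne_zero
  have q3 := pow_lt_pow_left₀ c3 (norm_nonneg _) two_ne_zero
  nlinarith [sq_nonneg (height k x)]

/-- A Liouville theorem on the chamber: a function that vanishes on the walls, is subharmonic where
it is positive, and is bounded by a power of `|x|` with exponent in `[-1/2, 61/40)`, is not
positive. -/
theorem nonpos_of_le_norm_rpow {k : Fin 4} {V : E → ℝ} {M γ : ℝ} (hγ : -(1 / 2) ≤ γ)
    (hγ' : γ < 61 / 40) (hV : ∀ x ∈ chamber k, ContDiffAt ℝ 2 V x)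
    (hsub : ∀ x ∈ chamber k, 0 < V x → 0 ≤ Δ V x)
    (hwall : ∀ i, i ≠ k → ∀ p ∈ openWall k i, ∀ ε > 0, ∀ᶠ x in 𝓝[chamber k] p, V x < ε)
    (hb : ∀ x ∈ chamber k, V x ≤ M * ‖x‖ ^ γ) : ∀ x ∈ chamber k, V x ≤ 0 := by
  obtain ⟨a, b, c, h⟩ := exists_isOrder k
  obtain ⟨c₀, hc₀, hB⟩ := exists_le_chamberBarrier
  replace hB := fun x hx => hB h x hx
  intro x hx
  refine le_of_forall_pos_le_add fun ε hε => ?_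
  rw [zero_add]
  have hBx : 0 ≤ chamberBarrier k a b c x :=
    le_trans (by positivity) (hB x hx)
  set ε' := ε / (chamberBarrier k a b c x + 1) with hε'
  have hε'0 : 0 < ε' := by positivity
  -- On a large sphere the barrier, of larger degree, exceeds `V`.
  have hlim : Tendsto (fun R : ℝ => ε' * c₀ * R ^ (61 / 40 - γ)) atTop atTop :=
    (tendsto_rpow_atTop (by linarith)).const_mul_atTop (by positivity)
  obtain ⟨R, hRM, hRx⟩ := ((hlim.eventually_ge_atTop M).and (eventually_gt_atTop ‖x‖)).exists
  have hR0 : 0 < R := (norm_nonneg x).trans_lt hRx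
  have hMR : M * R ^ γ ≤ ε' * c₀ * R ^ (61 / 40 : ℝ) := by
    have := mul_le_mul_of_nonneg_right hRM (by positivity : 0 ≤ R ^ γ)
    rwa [mul_assoc, ← Real.rpow_add hR0, sub_add_cancel] at this
  have hcomp := le_of_superharmonic h (O := Metric.ball 0 R) Metric.isOpen_ball
    Metric.isBounded_ball (V := V) (S := fun y => ε' * chamberBarrier k a b c y)
    (fun y hy => hV y hy.1) (fun y hy => hsub y hy.1)
    (fun y hy => by
      obtain ⟨G, l, hG, hl⟩ := exists_hasGradLap_chamberBarrier h hy.1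
      have h1 := hG.const_mul ε'
      have h2 : 0 ≤ chamberBarrier k a b c y := le_trans (by positivity) (hB y hy.1)
      exact ⟨h1.contDiffAt, by rw [h1.laplacian_eq]; nlinarith, by positivity⟩)
    (fun i hi p hp => hwall i hi p hp.1)
    (fun i hi p hp η hη => by
      by_cases hp0 : p = 0
      · have hct : ContinuousAt (fun y : E => M * ‖y‖ ^ (γ + 3 / 4)) p :=
          continuousAt_const.mul (continuousAt_id.norm.rpow_const (Or.inr (by linarith)))
        have hlt : M * ‖p‖ ^ (γ + 3 / 4) < η / 2 := by
          rw [hp0, norm_zero, Real.zero_rpow (by linarith)]; simpa using hη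
        filter_upwards [nhdsWithin_le_nhds (hct.eventually_lt continuousAt_const hlt),
          self_mem_nhdsWithin] with y hy hyc
        have hy0 : 0 < ‖y‖ := norm_pos_iff.2 (ne_zero_of_mem_chamber hyc)
        have h1 := norm_rpow_le_rayPole h hyc
        have h2 := mul_lt_mul_of_pos_right hy (by positivity : 0 < ‖y‖ ^ (-(3 / 4) : ℝ))
        rw [mul_assoc, ← Real.rpow_add hy0, show γ + 3 / 4 + -(3 / 4) = γ by ring] at h2
        nlinarith [hb y hyc]
      · have hct : ContinuousAt (fun y : E => M * ‖y‖ ^ γ) p :=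
          continuousAt_const.mul (continuousAt_id.norm.rpow_const
            (Or.inl (norm_ne_zero_iff.2 hp0)))
        filter_upwards [eventually_lt_rayPole h hi hp.1 ((M * ‖p‖ ^ γ + 1) / η),
          nhdsWithin_le_nhds (hct.eventually_lt continuousAt_const (lt_add_one (M * ‖p‖ ^ γ))),
          self_mem_nhdsWithin] with y hy hyM hyc
        rw [div_lt_iff₀' hη] at hy
        exact (hb y hyc).trans_lt (hyM.trans hy))
    (fun p hp hpn ε₁ hε₁ => by
      have hpR : ‖p‖ = R := by
        refine le_antisymm ?_ (by simpa using hpn)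
        have := Metric.closure_ball_subset_closedBall hp
        simpa using this
      have hp0 : ‖p‖ ≠ 0 := by rw [hpR]; exact hR0.ne'
      have hct : ContinuousAt
          (fun y : E => M * ‖y‖ ^ γ - ε' * c₀ * ‖y‖ ^ (61 / 40 : ℝ)) p :=
        (continuousAt_const.mul (continuousAt_id.norm.rpow_const (Or.inl hp0))).sub
          (continuousAt_const.mul (continuousAt_id.norm.rpow_const (Or.inl hp0)))
      have hlt : M * ‖p‖ ^ γ - ε' * c₀ * ‖p‖ ^ (61 / 40 : ℝ) < ε₁ := by rw [hpR]; linarith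
      filter_upwards [nhdsWithin_le_nhds (hct.eventually_lt continuousAt_const hlt),
        self_mem_nhdsWithin] with y hy hyD
      have h1 := hb y hyD.1
      have h2 := mul_le_mul_of_nonneg_left (hB y hyD.1) hε'0.le
      linarith)
  have hfin := hcomp x ⟨hx, by simpa using hRx⟩
  refine hfin.trans ?_
  change ε' * chamberBarrier k a b c x ≤ ε
  rw [hε', div_mul_eq_mul_div, div_le_iff₀ (by positivity)]
  nlinarith

/-! ### Homogeneous extensions of eigenfunctions -/

/-- The extension `r ^ γ⁺ φ_a(y)` of the `a`-th coordinate of a section over the sphere. -/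
def homogExt (lam : ℝ) (φ : Fin 4 → E → ℝ) (a : Fin 4) (x : E) : ℝ :=
  ‖x‖ ^ gammaPlus lam * radialExt (φ a) x

theorem neg_half_le_gammaPlus (lam : ℝ) : -(1 / 2) ≤ gammaPlus lam := by
  unfold gammaPlus; linarith [Real.sqrt_nonneg (1 / 4 + lam)]

/-- For `λ < -1/4` the square root in `γ⁺` is zero, and the inequality is strict. -/
theorem le_gammaPlus_mul (lam : ℝ) : lam ≤ gammaPlus lam * (gammaPlus lam + 1) := by
  have h : gammaPlus lam * (gammaPlus lam + 1) = √(1 / 4 + lam) ^ 2 - 1 / 4 := by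
    unfold gammaPlus; ring
  rw [h]
  rcases le_or_gt 0 (1 / 4 + lam) with h1 | h1
  · rw [Real.sq_sqrt h1]; linarith
  · nlinarith [Real.sqrt_nonneg (1 / 4 + lam)]

theorem gammaPlus_mul {lam : ℝ} (h : -(1 / 4) ≤ lam) :
    gammaPlus lam * (gammaPlus lam + 1) = lam := by
  have : √(1 / 4 + lam) ^ 2 = 1 / 4 + lam := Real.sq_sqrt (by linarith)
  unfold gammaPlus; linarith

theorem radialExt_smul (f : E → ℝ) {t : ℝ} (ht : 0 < t) (x : E) :
    radialExt f (t • x) = radialExt f x := by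
  unfold radialExt
  rw [norm_smul, Real.norm_of_nonneg ht.le, mul_inv, smul_smul, mul_right_comm,
    inv_mul_cancel₀ ht.ne', one_mul]

theorem radialExt_of_mem (f : E → ℝ) {y : E} (hy : y ∈ S2) : radialExt f y = f y := by
  have : ‖y‖ = 1 := by simpa using hy
  simp [radialExt, this]

theorem homogExt_smul (lam : ℝ) (φ : Fin 4 → E → ℝ) (a : Fin 4) {t : ℝ} (ht : 0 < t) (x : E) :
    homogExt lam φ a (t • x) = t ^ gammaPlus lam * homogExt lam φ a x := by
  unfold homogExt
  rw [radialExt_smul _ ht, norm_smul, Real.norm_of_nonneg ht.le, Real.mul_rpow ht.le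
    (norm_nonneg _), mul_assoc]

theorem inv_norm_smul_mem {x : E} (hx : x ≠ 0) : ‖x‖⁻¹ • x ∈ S2 := by
  simp [norm_smul, hx]

theorem ne_zero_of_mem_chart {a : Fin 4} {x : E} (hx : x ∈ chart a) : x ≠ 0 := by
  rintro rfl; exact zero_notMem_chart a hx

theorem inv_norm_smul_mem_chart {a : Fin 4} {x : E} (hx : x ∈ chart a) : ‖x‖⁻¹ • x ∈ chart a :=
  (smul_mem_chart (inv_pos.2 (norm_pos_iff.2 (ne_zero_of_mem_chart hx)))).2 hx

section Eigenfunction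

variable {lam : ℝ} {φ : Fin 4 → E → ℝ}

theorem IsEigenfunction.exists_hasGradLap (hφ : IsEigenfunction lam φ) {a : Fin 4} {x : E}
    (hx : x ∈ chart a) : ∃ G, HasGradLap (homogExt lam φ a) x G
      ((gammaPlus lam * (gammaPlus lam + 1) - lam) * homogExt lam φ a x / ‖x‖ ^ 2) := by
  have hx0 := ne_zero_of_mem_chart hx
  have hr : 0 < ‖x‖ := norm_pos_iff.2 hx0
  have hy : ‖x‖⁻¹ • x ∈ S2 ∩ chart a := ⟨inv_norm_smul_mem hx0, inv_norm_smul_mem_chart hx⟩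
  set f := radialExt (φ a) with hf
  have hfs : (fun y => f (‖x‖⁻¹ • y)) = f := by
    ext y; exact radialExt_smul _ (inv_pos.2 hr) y
  have hc : ContDiffAt ℝ 2 f x := by
    rw [← hfs]
    exact (hφ.contDiffAt a _ hy).comp x (contDiff_const_smul _).contDiffAt
  have hlap : Δ f x = -lam * f x / ‖x‖ ^ 2 := by
    have h1 := laplacian_comp_smul (f := f) ‖x‖⁻¹ (hφ.contDiffAt a _ hy)
    rw [hfs] at h1
    have h2 := hφ.eigen a _ hy
    rw [← radialExt_of_mem (φ a) hy.1, radialExt_smul _ (inv_pos.2 hr)] at h2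
    rw [h1, show Δ f (‖x‖⁻¹ • x) = -lam * f x by
      have : sphereLaplacian (φ a) (‖x‖⁻¹ • x) = Δ f (‖x‖⁻¹ • x) := rfl
      rw [← this]; linarith]
    field_simp
  have hg := hasGradLap_of_contDiffAt hc
  have hrad : inner ℝ (gradient f x) x = 0 := by
    have h0 : HasFDerivAt f (innerSL ℝ (gradient f x)) ((1 : ℝ) • x) := by
      rw [one_smul]; exact hg.hasFDerivAt
    have h1 : HasDerivAt (fun t : ℝ => t • x) x 1 := by
      simpa using (hasDerivAt_id (1 : ℝ)).smul_const x
    have h2 := h0.comp_hasDerivAt (1 : ℝ) h1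
    have h3 : HasDerivAt (f ∘ fun t : ℝ => t • x) 0 1 := by
      refine (hasDerivAt_const (1 : ℝ) (f x)).congr_of_eventuallyEq ?_
      filter_upwards [lt_mem_nhds (zero_lt_one' ℝ)] with t ht
      exact radialExt_smul _ ht x
    exact h2.unique h3
  have hq := (hasGradLap_norm hx0).rpow hr (gammaPlus lam)
  refine ⟨_, (hq.mul hg).congr_val rfl ?_⟩
  rw [hlap, real_inner_smul_left, real_inner_smul_left, real_inner_comm, hrad,
    Real.rpow_sub_one hr.ne', Real.rpow_sub hr _ 2, Real.rpow_ofNat, norm_smul, norm_inv, norm_norm,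
    inv_mul_cancel₀ hr.ne', finrank_euclideanSpace_fin, homogExt]
  push_cast
  field_simp
  ring

theorem IsEigenfunction.abs_homogExt_le (hφ : IsEigenfunction lam φ) :
    ∃ M, 0 ≤ M ∧ ∀ a, ∀ x ∈ chart a, |homogExt lam φ a x| ≤ M * ‖x‖ ^ gammaPlus lam := by
  obtain ⟨M, hM⟩ := hφ.bounded
  refine ⟨|M|, abs_nonneg _, fun a x hx => ?_⟩
  rw [homogExt, abs_mul, abs_of_nonneg (by positivity), mul_comm]
  exact mul_le_mul_of_nonneg_right ((hM a _ ⟨inv_norm_smul_mem (ne_zero_of_mem_chart hx),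
    inv_norm_smul_mem_chart hx⟩).trans (le_abs_self M)) (by positivity)

theorem IsEigenfunction.homogExt_eq_zero (hφ : IsEigenfunction lam φ) {k i : Fin 4} (hi : i ≠ k)
    {p : E} (hp : p ∈ openWall k i) : homogExt lam φ k p = 0 := by
  have hp0 := ne_zero_of_mem_chart (openWall_subset_chart hi.symm hp).1
  rw [homogExt, radialExt, hφ.equivariant.eq_zero hφ.isSection hi.symm (inv_norm_smul_mem hp0)
    ((smul_mem_openWall (inv_pos.2 (norm_pos_iff.2 hp0))).2 hp), mul_zero]

/-- The exponents of nonzero `Γ`-equivariant eigenfunctions are at least `61/40`, and in particular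
greater than `3/2`. -/
theorem IsEigenfunction.le_gammaPlus (hφ : IsEigenfunction lam φ) {k : Fin 4} {x : E}
    (hx : x ∈ chamber k) (hne : homogExt lam φ k x ≠ 0) : 61 / 40 ≤ gammaPlus lam := by
  by_contra! hlt
  obtain ⟨M, hM, hb⟩ := hφ.abs_homogExt_le
  have hk := fun y (hy : y ∈ chamber k) => chamber_subset_chart k k hy
  have hκ : 0 ≤ gammaPlus lam * (gammaPlus lam + 1) - lam := sub_nonneg.2 (le_gammaPlus_mul lam)
  have key : ∀ σ : ℝ, |σ| = 1 → ∀ y ∈ chamber k, σ * homogExt lam φ k y ≤ 0 := by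
    intro σ hσ
    refine nonpos_of_le_norm_rpow (M := M) (V := fun y => σ * homogExt lam φ k y)
      (neg_half_le_gammaPlus lam) hlt (fun y hy => ?_) (fun y hy hpos => ?_)
      (fun i hi p hp ε hε => ?_) (fun y hy => ?_)
    · obtain ⟨G, hG⟩ := hφ.exists_hasGradLap (hk y hy)
      exact (hG.const_mul σ).contDiffAt
    · obtain ⟨G, hG⟩ := hφ.exists_hasGradLap (hk y hy)
      rw [(hG.const_mul σ).laplacian_eq, ← mul_div_assoc, mul_left_comm]
      positivity
    · obtain ⟨G, hG⟩ := hφ.exists_hasGradLap (openWall_subset_chart hi.symm hp).1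
      refine nhdsWithin_le_nhds ((hG.const_mul σ).contDiffAt.continuousAt.eventually_lt
        continuousAt_const ?_)
      simpa [hφ.homogExt_eq_zero hi hp] using hε
    · refine (le_abs_self _).trans ?_
      rw [abs_mul, hσ, one_mul]
      exact hb k y (hk y hy)
  have h1 := key 1 (by norm_num) x hx
  have h2 := key (-1) (by norm_num) x hx
  exact hne (by linarith)

end Eigenfunction

/-! ### The mean value inequality -/

section MeanValue

open MeasureTheory

theorem hasDerivAt_max_zero_pow {n : ℕ} (hn : n ≠ 0) (t : ℝ) :
    HasDerivAt (fun t : ℝ => max t 0 ^ (n + 1)) ((n + 1) * max t 0 ^ n) t := by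
  have hne : ∀ y : ℝ, y ≠ 0 →
      HasDerivAt (fun t : ℝ => max t 0 ^ (n + 1)) ((n + 1) * max y 0 ^ n) y := by
    intro y hy
    rcases lt_or_gt_of_ne hy with h | h
    · rw [max_eq_right h.le, zero_pow hn, mul_zero]
      refine (hasDerivAt_const y (0 : ℝ)).congr_of_eventuallyEq ?_
      filter_upwards [gt_mem_nhds h] with z hz
      rw [max_eq_right hz.le, zero_pow n.succ_ne_zero]
    · rw [max_eq_left h.le]
      refine (by simpa using hasDerivAt_pow (n + 1) y :
        HasDerivAt (fun z : ℝ => z ^ (n + 1)) ((n + 1) * y ^ n) y).congr_of_eventuallyEq ?_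
      filter_upwards [lt_mem_nhds h] with z hz
      rw [max_eq_left hz.le]
  by_cases ht : t = 0
  · subst ht
    exact hasDerivAt_of_hasDerivAt_of_ne (g := fun t : ℝ => (n + 1) * max t 0 ^ n) hne
      (by fun_prop) (by fun_prop)
  · exact hne t ht

variable {V : Type*} [NormedAddCommGroup V]

/-- The weight `(1 - |z|²)₊` on the unit ball. -/
def ballWeight (z : V) : ℝ := max (1 - ‖z‖ ^ 2) 0

theorem continuous_ballWeight : Continuous (ballWeight : V → ℝ) := by
  unfold ballWeight; fun_prop

theorem ballWeight_nonneg (z : V) : 0 ≤ ballWeight z := le_max_right _ _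

theorem ballWeight_le_one (z : V) : ballWeight z ≤ 1 :=
  max_le (by linarith [sq_nonneg ‖z‖]) zero_le_one

theorem ballWeight_eq_zero {z : V} (hz : 1 ≤ ‖z‖) : ballWeight z = 0 :=
  max_eq_right (by nlinarith)

theorem ballWeight_pos {z : V} (hz : ‖z‖ < 1) : 0 < ballWeight z :=
  lt_max_of_lt_left (by nlinarith [norm_nonneg z])

variable [InnerProductSpace ℝ V]

/-- `(1 - |z|²)₊² / 4` is a potential of the vector field `-(1 - |z|²)₊ z`. -/
theorem hasFDerivAt_ballWeight_sq (z : V) : HasFDerivAt (fun z : V => ballWeight z ^ 2 / 4)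
    (-(ballWeight z) • innerSL ℝ z) z := by
  have h1 : HasFDerivAt (fun z : V => 1 - ‖z‖ ^ 2) (-(2 • innerSL ℝ z)) z :=
    (hasStrictFDerivAt_norm_sq z).hasFDerivAt.const_sub 1
  have h2 := (hasDerivAt_max_zero_pow one_ne_zero (1 - ‖z‖ ^ 2)).comp_hasFDerivAt z h1
  have h3 := h2.mul_const (1 / 4 : ℝ)
  refine (h3.congr_of_eventuallyEq (Eventually.of_forall fun y => ?_)).congr_fderiv ?_
  · simp [ballWeight, div_eq_mul_inv]
  · ext y
    simp [ballWeight]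
    ring

variable [FiniteDimensional ℝ V]

theorem hasCompactSupport_ballWeight : HasCompactSupport (ballWeight : V → ℝ) :=
  HasCompactSupport.intro (isCompact_closedBall 0 1) fun z hz => ballWeight_eq_zero (by
    rw [mem_closedBall_zero_iff, not_le] at hz; exact hz.le)

variable [MeasurableSpace V] [BorelSpace V]

theorem integral_ballWeight_pos : 0 < ∫ z : V, ballWeight z :=
  continuous_ballWeight.integral_pos_of_hasCompactSupport_nonneg_nonzero
    hasCompactSupport_ballWeight ballWeight_nonneg (x := 0) (ballWeight_pos (by simp)).ne'

/-- The derivative in `s` of the weighted mean of `w` over the ball of radius `s` is, after an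
integration by parts, a weighted mean of `Δ w`. -/
theorem integral_fderiv_mul_ballWeight_nonneg {w : V → ℝ} (hw : ContDiff ℝ 2 w)
    (hΔ : ∀ y, 0 ≤ Δ w y) (x : V) {s : ℝ} (hs : 0 ≤ s) :
    0 ≤ ∫ z : V, fderiv ℝ w (x + s • z) z * ballWeight z := by
  have b := stdOrthonormalBasis ℝ V
  have hD : ContDiff ℝ 1 (fderiv ℝ w) := hw.fderiv_right (by norm_num)
  have hDc : Continuous (fun z : V => fderiv ℝ w (x + s • z)) := by
    exact hD.continuous.comp (by fun_prop)
  have hDD : Continuous (fun z : V => fderiv ℝ (fderiv ℝ w) (x + s • z)) := by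
    exact (hD.continuous_fderiv (by norm_num)).comp (by fun_prop)
  set K : V → ℝ := fun z => ballWeight z ^ 2 / 4 with hK
  have hKc : Continuous K := (continuous_ballWeight.pow 2).div_const 4
  have hKs : HasCompactSupport K :=
    hasCompactSupport_ballWeight.comp_left (g := fun t : ℝ => t ^ 2 / 4) (by norm_num)
  have hKd : ∀ z v, fderiv ℝ K z v = -(ballWeight z * inner ℝ z v) := fun z v => by
    rw [(hasFDerivAt_ballWeight_sq z).fderiv]; simp
  have hline : ∀ i z, HasFDerivAt (fun z : V => fderiv ℝ w (x + s • z) (b i))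
      (s • (fderiv ℝ (fderiv ℝ w) (x + s • z)).flip (b i)) z := by
    intro i z
    have h1 : HasFDerivAt (fun z : V => x + s • z) (s • ContinuousLinearMap.id ℝ V) z :=
      ((hasFDerivAt_id z).const_smul s).const_add x
    have h2 := ((hD.differentiable (by norm_num) (x + s • z)).hasFDerivAt.comp z h1).clm_apply
      (hasFDerivAt_const (b i) z)
    refine h2.congr_fderiv ?_
    ext v; simp
  have hparts : ∀ i, ∫ z : V, fderiv ℝ w (x + s • z) (b i) * (ballWeight z * inner ℝ z (b i)) =
      ∫ z : V, s * fderiv ℝ (fderiv ℝ w) (x + s • z) (b i) (b i) * K z := by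
    intro i
    have h1 := integral_mul_fderiv_eq_neg_fderiv_mul_of_integrable (μ := (volume : Measure V))
      (f := fun z : V => fderiv ℝ w (x + s • z) (b i)) (g := K) (v := b i) ?_ ?_ ?_ ?_ ?_
    · simp only [hKd, (hline i _).fderiv, mul_neg, integral_neg, neg_inj] at h1
      rw [h1]; rfl
    · simp only [(hline i _).fderiv]
      refine Continuous.integrable_of_hasCompactSupport ?_ hKs.mul_left
      exact (continuous_const.mul ((hDD.clm_apply continuous_const).clm_apply
        continuous_const)).mul hKc
    · simp only [hKd]
      refine Continuous.integrable_of_hasCompactSupport ?_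
        (HasCompactSupport.mul_left (f' := fun z : V => -(ballWeight z * inner ℝ z (b i))) ?_)
      · exact (hDc.clm_apply continuous_const).mul (continuous_ballWeight.mul (by fun_prop)).neg
      · exact (hasCompactSupport_ballWeight.mul_right).neg
    · exact ((hDc.clm_apply continuous_const).mul hKc).integrable_of_hasCompactSupport hKs.mul_left
    · exact fun z _ => (hline i z).differentiableAt
    · exact fun z _ => (hasFDerivAt_ballWeight_sq z).differentiableAt
  have hint : ∀ i, Integrable (fun z : V => fderiv ℝ w (x + s • z) (b i) *
      (ballWeight z * inner ℝ z (b i))) := fun i => by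
    refine Continuous.integrable_of_hasCompactSupport ?_
      (HasCompactSupport.mul_left (f' := fun z : V => ballWeight z * inner ℝ z (b i)) ?_)
    · exact (hDc.clm_apply continuous_const).mul (continuous_ballWeight.mul (by fun_prop))
    · exact hasCompactSupport_ballWeight.mul_right
  have hint' : ∀ i, Integrable (fun z : V =>
      s * fderiv ℝ (fderiv ℝ w) (x + s • z) (b i) (b i) * K z) := fun i =>
    Continuous.integrable_of_hasCompactSupport ((continuous_const.mul ((hDD.clm_apply
      continuous_const).clm_apply continuous_const)).mul hKc) hKs.mul_left
  have hexp : ∀ z : V, fderiv ℝ w (x + s • z) z * ballWeight z =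
      ∑ i, fderiv ℝ w (x + s • z) (b i) * (ballWeight z * inner ℝ z (b i)) := by
    intro z
    conv_lhs => rw [show fderiv ℝ w (x + s • z) z = fderiv ℝ w (x + s • z)
      (∑ i, (inner ℝ (b i) z : ℝ) • b i) by rw [b.sum_repr' z]]
    rw [map_sum, Finset.sum_mul]
    refine Finset.sum_congr rfl fun i _ => ?_
    rw [map_smul, smul_eq_mul, real_inner_comm]; ring
  simp only [hexp]
  rw [integral_finsetSum _ fun i _ => hint i, Finset.sum_congr rfl fun i _ => hparts i,
    ← integral_finsetSum _ fun i _ => hint' i]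
  refine integral_nonneg fun z => ?_
  have : ∑ i, s * fderiv ℝ (fderiv ℝ w) (x + s • z) (b i) (b i) * K z =
      s * Δ w (x + s • z) * K z := by
    rw [laplacian_eq_sum_fderiv b, Finset.mul_sum, Finset.sum_mul]
  change 0 ≤ ∑ i, s * fderiv ℝ (fderiv ℝ w) (x + s • z) (b i) (b i) * K z
  rw [this]
  have h1 := hΔ (x + s • z)
  have h2 : 0 ≤ K z := by simp only [hK]; positivity
  positivity

theorem hasDerivAt_integral_ballWeight {w : V → ℝ} (hw : ContDiff ℝ 1 w) (x : V) (s : ℝ) :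
    HasDerivAt (fun s : ℝ => ∫ z : V, w (x + s • z) * ballWeight z)
      (∫ z : V, fderiv ℝ w (x + s • z) z * ballWeight z) s := by
  have hD : Continuous (fderiv ℝ w) := hw.continuous_fderiv (by norm_num)
  have hcomp : IsCompact (Metric.closedBall s 1 ×ˢ Metric.closedBall (0 : V) 1) :=
    (isCompact_closedBall s 1).prod (isCompact_closedBall 0 1)
  have hcont : Continuous fun q : ℝ × V => fderiv ℝ w (x + q.1 • q.2) q.2 := by fun_prop
  obtain ⟨C, hC⟩ := hcomp.exists_bound_of_continuousOn hcont.continuousOn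
  have hG := (continuous_ballWeight (V := V)).integrable_of_hasCompactSupport (μ := volume)
    hasCompactSupport_ballWeight
  refine (hasDerivAt_integral_of_dominated_loc_of_deriv_le (μ := (volume : Measure V))
    (bound := fun z => C * ballWeight z)
    (F' := fun s z => fderiv ℝ w (x + s • z) z * ballWeight z)
    (Metric.closedBall_mem_nhds s one_pos) ?_ ?_ ?_ ?_ (hG.const_mul C) ?_).2
  · refine Eventually.of_forall fun t => Continuous.aestronglyMeasurable ?_
    exact (hw.continuous.comp (by fun_prop)).mul continuous_ballWeight
  · exact ((hw.continuous.comp (by fun_prop)).mul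
      continuous_ballWeight).integrable_of_hasCompactSupport hasCompactSupport_ballWeight.mul_left
  · refine Continuous.aestronglyMeasurable ?_
    exact (by fun_prop : Continuous fun z : V => fderiv ℝ w (x + s • z) z).mul
      continuous_ballWeight
  · refine Eventually.of_forall fun z t ht => ?_
    rw [norm_mul, Real.norm_of_nonneg (ballWeight_nonneg z)]
    by_cases hz : ‖z‖ ≤ 1
    · exact mul_le_mul_of_nonneg_right (hC (t, z) ⟨ht, by simpa using hz⟩) (ballWeight_nonneg z)
    · rw [ballWeight_eq_zero (not_le.1 hz).le, mul_zero, mul_zero]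
  · refine Eventually.of_forall fun z t _ => ?_
    have h1 : HasDerivAt (fun t : ℝ => x + t • z) z t := by
      simpa using ((hasDerivAt_id t).smul_const z).const_add x
    exact (((hw.differentiable (by norm_num) _).hasFDerivAt.comp_hasDerivAt t h1)).mul_const _

/-- The mean value inequality for `C²` subharmonic functions. -/
theorem mul_integral_ballWeight_le {w : V → ℝ} (hw : ContDiff ℝ 2 w) (hΔ : ∀ y, 0 ≤ Δ w y)
    (hw0 : ∀ y, 0 ≤ w y) (x : V) {R : ℝ} (hR : 0 < R) :
    w x * ∫ z : V, ballWeight z ≤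
      (R ^ Module.finrank ℝ V)⁻¹ * ∫ y in Metric.ball x R, w y := by
  have hw1 : ContDiff ℝ 1 w := hw.of_le (by norm_num)
  set F : ℝ → ℝ := fun s => ∫ z : V, w (x + s • z) * ballWeight z with hF
  have hmono : MonotoneOn F (Ici 0) := by
    refine monotoneOn_of_deriv_nonneg (convex_Ici 0)
      (fun s _ => (hasDerivAt_integral_ballWeight hw1 x s).continuousAt.continuousWithinAt)
      (fun s _ => (hasDerivAt_integral_ballWeight hw1 x s).differentiableAt.differentiableWithinAt)
      fun s hs => ?_
    rw [interior_Ici] at hs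
    rw [(hasDerivAt_integral_ballWeight hw1 x s).deriv]
    exact integral_fderiv_mul_ballWeight_nonneg hw hΔ x (le_of_lt hs)
  have h0 : F 0 = w x * ∫ z : V, ballWeight z := by
    simp only [hF, zero_smul, add_zero, integral_const_mul]
  have hwc : Continuous fun z : V => w (x + R • z) := hw.continuous.comp (by fun_prop)
  have hFR : F R ≤ ∫ z in Metric.ball (0 : V) 1, w (x + R • z) := by
    have : F R = ∫ z in Metric.ball (0 : V) 1, w (x + R • z) * ballWeight z := by
      rw [setIntegral_eq_integral_of_forall_compl_eq_zero]
      intro z hz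
      rw [mem_ball_zero_iff, not_lt] at hz
      rw [ballWeight_eq_zero hz, mul_zero]
    rw [this]
    have hi : IntegrableOn (fun z : V => w (x + R • z)) (Metric.ball 0 1) :=
      (hwc.continuousOn.integrableOn_compact (isCompact_closedBall 0 1)).mono_set
        Metric.ball_subset_closedBall
    have hi' : IntegrableOn (fun z : V => w (x + R • z) * ballWeight z) (Metric.ball 0 1) :=
      ((hwc.mul continuous_ballWeight).continuousOn.integrableOn_compact
        (isCompact_closedBall 0 1)).mono_set Metric.ball_subset_closedBall
    exact setIntegral_mono hi' hi fun z =>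
      mul_le_of_le_one_right (hw0 _) (ballWeight_le_one z)
  have hscale : ∫ z in Metric.ball (0 : V) 1, w (x + R • z) =
      (R ^ Module.finrank ℝ V)⁻¹ * ∫ y in Metric.ball x R, w y := by
    rw [Measure.setIntegral_comp_smul_of_pos volume (fun y => w (x + y)) _ hR, smul_eq_mul,
      smul_unitBall_of_pos hR]
    congr 1
    rw [← integral_indicator Metric.isOpen_ball.measurableSet,
      ← integral_indicator Metric.isOpen_ball.measurableSet,
      ← integral_add_left_eq_self ((Metric.ball x R).indicator w) x]
    congr 1
    ext y
    simp [indicator]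
  calc w x * ∫ z : V, ballWeight z = F 0 := h0.symm
    _ ≤ F R := hmono (by simp) (by simpa using hR.le) hR.le
    _ ≤ _ := hFR.trans hscale.le

end MeanValue

/-! ### From `L²` bounds to pointwise bounds in a chamber -/

section SupBound

open MeasureTheory

theorem contDiff_max_zero_pow_three : ContDiff ℝ 2 fun t : ℝ => max t 0 ^ 3 := by
  have h3 : ∀ t, HasDerivAt (fun t : ℝ => max t 0 ^ 3) (3 * max t 0 ^ 2) t := fun t => by
    refine (hasDerivAt_max_zero_pow two_ne_zero t).congr_deriv ?_
    norm_num
  have h2 : ∀ t, HasDerivAt (fun t : ℝ => 3 * max t 0 ^ 2) (3 * (2 * max t 0)) t := fun t => by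
    refine ((hasDerivAt_max_zero_pow one_ne_zero t).const_mul 3).congr_deriv ?_
    norm_num
  rw [show (2 : WithTop ℕ∞) = 1 + 1 by norm_num, contDiff_succ_iff_deriv]
  refine ⟨fun t => (h3 t).differentiableAt, by simp, ?_⟩
  rw [funext fun t => (h3 t).deriv, contDiff_one_iff_deriv]
  refine ⟨fun t => (h2 t).differentiableAt, ?_⟩
  rw [funext fun t => (h2 t).deriv]
  fun_prop

/-- A convex function that vanishes for `t ≤ 1`, is `C²` for `t > 0`, and has quadratic growth. -/
def quadCutoff (t : ℝ) : ℝ := max (t - 1) 0 ^ 3 * t⁻¹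

theorem quadCutoff_of_le {t : ℝ} (ht : t ≤ 1) : quadCutoff t = 0 := by
  rw [quadCutoff, max_eq_right (by linarith)]; simp

theorem quadCutoff_nonneg (t : ℝ) : 0 ≤ quadCutoff t := by
  rcases le_or_gt t 1 with h | h
  · rw [quadCutoff_of_le h]
  · unfold quadCutoff; positivity

theorem quadCutoff_le_sq (t : ℝ) : quadCutoff t ≤ t ^ 2 := by
  rcases le_or_gt t 1 with h | h
  · rw [quadCutoff_of_le h]; positivity
  · have h0 : 0 < t := by linarith
    rw [quadCutoff, max_eq_left (by linarith), ← div_eq_mul_inv, div_le_iff₀ h0, ← pow_succ]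
    exact pow_le_pow_left₀ (by linarith) (by linarith) 3

theorem exists_hasGradLap_quadCutoff {f : E → ℝ} {x G : E} (hf : HasGradLap f x G 0)
    (h1 : 1 ≤ f x) : ∃ H l, HasGradLap (fun y => quadCutoff (f y)) x H l ∧ 0 ≤ l := by
  have hcube := hf.comp (φ := fun t => max (t - 1) 0 ^ 3) (φ' := fun t => 3 * max (t - 1) 0 ^ 2)
    (φ'' := 3 * (2 * max (f x - 1) 0))
    (contDiff_max_zero_pow_three.comp (contDiff_id.sub contDiff_const)).contDiffAt
    (Eventually.of_forall fun t => by
      have := (hasDerivAt_max_zero_pow two_ne_zero (t - 1)).comp_sub_const t 1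
      exact this.congr_deriv (by norm_num))
    (by
      have := ((hasDerivAt_max_zero_pow one_ne_zero (f x - 1)).comp_sub_const (f x) 1).const_mul 3
      exact (this.congr_of_eventuallyEq (Eventually.of_forall fun t => by simp)).congr_deriv
        (by norm_num))
  have hx : 0 < f x := by linarith
  refine ⟨_, _, hcube.mul (hf.inv hx.ne'), ?_⟩
  rw [max_eq_left (by linarith), real_inner_smul_left, real_inner_smul_right,
    real_inner_self_eq_norm_sq]
  set m := f x - 1 with hm
  have hm0 : 0 ≤ m := by linarith
  have e : m ^ 3 * (2 / f x ^ 3 * ‖G‖ ^ 2 - 0 / f x ^ 2) +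
      (f x)⁻¹ * (3 * (2 * m) * ‖G‖ ^ 2 + 3 * m ^ 2 * 0) +
      2 * (3 * m ^ 2 * (-(f x ^ 2)⁻¹ * ‖G‖ ^ 2)) =
      2 * m * ‖G‖ ^ 2 / f x ^ 3 * (m ^ 2 - 3 * m * f x + 3 * f x ^ 2) := by
    field_simp; ring
  rw [e]
  refine mul_nonneg (by positivity) ?_
  nlinarith [sq_nonneg (m - f x), sq_nonneg (m - 3 / 2 * f x)]

/-- A harmonic function on a chamber that tends to zero at its boundary is bounded at `x` by its
`L²` norm over a ball around `x`: a convex cutoff of it, extended by zero, is a `C²` subharmonic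
function on the whole space. -/
theorem sq_mul_le_setIntegral_sq {k : Fin 4} {v : E → ℝ}
    (hv : ∀ x ∈ chamber k, ∃ G, HasGradLap v x G 0)
    (hbd : ∀ p ∈ closure (chamber k), p ∉ chamber k → Tendsto v (𝓝[chamber k] p) (𝓝 0))
    {x : E} (hx : x ∈ chamber k) (hpos : 0 < v x) {R : ℝ} (hR : 0 < R)
    (hint : IntegrableOn (fun y => v y ^ 2) (Metric.ball x R ∩ chamber k)) :
    v x ^ 2 * ∫ z : E, ballWeight z ≤
      8 * (R ^ 3)⁻¹ * ∫ y in Metric.ball x R ∩ chamber k, v y ^ 2 := by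
  set δ := v x / 2 with hδ
  have hδ0 : 0 < δ := by positivity
  set w : E → ℝ := (chamber k).indicator fun y => quadCutoff (δ⁻¹ * v y) with hw
  have hzero : ∀ y, y ∉ chamber k ∨ v y < δ → w =ᶠ[𝓝 y] fun _ => 0 := by
    intro y hy
    have hsmall : ∀ᶠ z in 𝓝[chamber k] y, v z < δ := by
      by_cases hyc : y ∈ chamber k
      · obtain ⟨G, hG⟩ := hv y hyc
        exact nhdsWithin_le_nhds (hG.contDiffAt.continuousAt.eventually_lt continuousAt_const
          (hy.resolve_left (not_not.2 hyc)))
      · by_cases hycl : y ∈ closure (chamber k)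
        · exact (hbd y hycl hyc).eventually_lt_const hδ0
        · rw [mem_closure_iff_nhdsWithin_neBot, not_neBot] at hycl
          rw [hycl]; exact eventually_bot
    filter_upwards [eventually_nhdsWithin_iff.1 hsmall] with z hz
    by_cases hzc : z ∈ chamber k
    · rw [hw, indicator_of_mem hzc, quadCutoff_of_le]
      rw [inv_mul_le_iff₀ hδ0, mul_one]
      exact (hz hzc).le
    · rw [hw, indicator_of_notMem hzc]
  have hgl : ∀ y, ∃ H l, HasGradLap w y H l ∧ 0 ≤ l := by
    intro y
    by_cases hy : y ∉ chamber k ∨ v y < δ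
    · exact ⟨_, _, (hasGradLap_const 0 y).congr (hzero y hy).symm, le_rfl⟩
    · push Not at hy
      obtain ⟨G, hG⟩ := hv y hy.1
      obtain ⟨H, l, hH, hl⟩ := exists_hasGradLap_quadCutoff
        ((hG.const_mul δ⁻¹).congr_val rfl (mul_zero _))
        (by rw [← div_eq_inv_mul, le_div_iff₀ hδ0, one_mul]; exact hy.2)
      refine ⟨H, l, hH.congr ?_, hl⟩
      filter_upwards [(isOpen_chamber k).mem_nhds hy.1] with z hz
      rw [hw, indicator_of_mem hz]
  have hwc : ContDiff ℝ 2 w := contDiff_iff_contDiffAt.2 fun y => by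
    obtain ⟨H, l, hH, -⟩ := hgl y; exact hH.contDiffAt
  have hw0 : ∀ y, 0 ≤ w y := fun y => indicator_nonneg (fun z _ => quadCutoff_nonneg _) y
  have hmv := mul_integral_ballWeight_le hwc (fun y => by
    obtain ⟨H, l, hH, hl⟩ := hgl y; rw [hH.laplacian_eq]; exact hl) hw0 x hR
  rw [finrank_euclideanSpace_fin] at hmv
  have hwx : w x = 1 / 2 := by
    have : δ⁻¹ * v x = 2 := by rw [hδ]; field_simp
    rw [hw, indicator_of_mem hx, this, quadCutoff]; norm_num
  have hle : ∫ y in Metric.ball x R, w y ≤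
      (δ ^ 2)⁻¹ * ∫ y in Metric.ball x R ∩ chamber k, v y ^ 2 := by
    rw [hw, setIntegral_indicator (isOpen_chamber k).measurableSet, ← integral_const_mul]
    refine integral_mono_of_nonneg (Eventually.of_forall fun y => quadCutoff_nonneg _)
      (hint.const_mul _) (Eventually.of_forall fun y => ?_)
    refine (quadCutoff_le_sq _).trans ?_
    rw [mul_pow, inv_pow]
  rw [hwx] at hmv
  have h3 := hmv.trans (mul_le_mul_of_nonneg_left hle (by positivity : 0 ≤ (R ^ 3)⁻¹))
  have h4 := mul_le_mul_of_nonneg_left h3 (by positivity : 0 ≤ 8 * δ ^ 2)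
  calc v x ^ 2 * ∫ z : E, ballWeight z = 8 * δ ^ 2 * (1 / 2 * ∫ z : E, ballWeight z) := by
        rw [hδ]; ring
    _ ≤ _ := h4
    _ = _ := by field_simp

end SupBound

/-! ### Integration over the sphere and polar coordinates -/

section Polar

open MeasureTheory

/-- The surface measure of the unit sphere. -/
abbrev sphereMeasure : Measure S2 := (volume : Measure E).toSphere

theorem volume_wall (i j : Fin 4) : (volume : Measure E) (wall i j) = 0 := by
  obtain ⟨m, n, hmn, hmi, hmj, hni, hnj⟩ := exists_three i j
  set s : Submodule ℝ E := (innerSL ℝ (vertex m - vertex n)).ker with hs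
  refine measure_mono_null (t := (s : Set E)) (fun x hx => ?_)
    (Measure.addHaar_submodule volume s fun htop => ?_)
  · have := (height_of_mem_wall hx hmi hmj n).2 hni hnj
    simp only [hs, SetLike.mem_coe, LinearMap.mem_ker]
    change inner ℝ (vertex m - vertex n) x = (0 : ℝ)
    rw [inner_sub_left]
    exact sub_eq_zero.2 this.symm
  · have : vertex m ∈ s := htop ▸ Submodule.mem_top
    have h0 : inner ℝ (vertex m - vertex n) (vertex m) = (0 : ℝ) := this
    rw [inner_sub_left, inner_vertex, inner_vertex, if_pos rfl, if_neg hmn.symm] at h0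
    norm_num at h0

theorem ae_mem_chart (a : Fin 4) : ∀ᵐ y : S2 ∂sphereMeasure, (y : E) ∈ chart a := by
  have hm : MeasurableSet {y : S2 | ¬ (y : E) ∈ chart a} :=
    (((isOpen_chart a).preimage continuous_subtype_val).measurableSet).compl
  rw [ae_iff, Measure.toSphere_apply' _ hm]
  suffices h : (volume : Measure E) (⋃ b, wall a b) = 0 by
    rw [measure_mono_null ?_ h, mul_zero]
    rintro _ ⟨t, ht, _, ⟨y, hy, rfl⟩, rfl⟩
    obtain ⟨b, hb⟩ := mem_iUnion.1 (not_not.1 hy : (y : E) ∈ ⋃ b, wall a b)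
    exact mem_iUnion.2 ⟨b, (smul_mem_wall ht.1).2 hb⟩
  exact measure_iUnion_null fun b => volume_wall a b

/-- A nonnegative function whose integrals over the spheres of radius `r < 1` are at most `Q` has
integral at most `Q` over the unit ball. -/
theorem lintegral_ball_le_of_sphere {f : E → ENNReal} (hf : Measurable f) (Q : ENNReal)
    (h : ∀ r ∈ Ioo (0 : ℝ) 1, ∫⁻ y : S2, f (r • (y : E)) ∂sphereMeasure ≤ Q) :
    ∫⁻ x in Metric.ball (0 : E) 1, f x ≤ Q := by
  set g : E → ENNReal := (Metric.ball (0 : E) 1).indicator f with hg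
  have hgm : Measurable g := hf.indicator Metric.isOpen_ball.measurableSet
  have hcompl : ∫⁻ x, g x = ∫⁻ x in ({0}ᶜ : Set E), g x := by
    rw [restrict_compl_singleton]
  have hmp := (volume : Measure E).measurePreserving_homeomorphUnitSphereProd
  have hFm : Measurable fun p : S2 × Ioi (0 : ℝ) => g ((p.2 : ℝ) • (p.1 : E)) := by
    have hc : Continuous fun p : S2 × Ioi (0 : ℝ) => (p.2 : ℝ) • (p.1 : E) := by fun_prop
    exact hgm.comp hc.measurable
  have hpol : ∫⁻ x : ({0}ᶜ : Set E), g x ∂((volume : Measure E).comap (↑)) =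
      ∫⁻ p, g ((p.2 : ℝ) • (p.1 : E)) ∂(sphereMeasure.prod
        (Measure.volumeIoiPow (Module.finrank ℝ E - 1))) := by
    rw [← hmp.lintegral_comp hFm]
    refine lintegral_congr fun x => ?_
    have hx : ‖(x : E)‖ ≠ 0 := norm_ne_zero_iff.2 x.2
    simp [smul_smul, hx]
  rw [← lintegral_indicator Metric.isOpen_ball.measurableSet, ← hg, hcompl,
    ← lintegral_subtype_comap (measurableSet_singleton _).compl, hpol,
    lintegral_prod_symm' _ hFm, finrank_euclideanSpace_fin]
  calc ∫⁻ r : Ioi (0 : ℝ), ∫⁻ y : S2, g ((r : ℝ) • (y : E)) ∂sphereMeasure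
        ∂(Measure.volumeIoiPow (3 - 1))
      ≤ ∫⁻ r : Ioi (0 : ℝ), (Iio (⟨1, mem_Ioi.2 one_pos⟩ : Ioi (0 : ℝ))).indicator (fun _ => Q) r
        ∂(Measure.volumeIoiPow (3 - 1)) := by
        refine lintegral_mono fun r => ?_
        by_cases hr : (r : ℝ) < 1
        · rw [indicator_of_mem (show r ∈ Iio (⟨1, mem_Ioi.2 one_pos⟩ : Ioi (0 : ℝ)) from hr)]
          exact (lintegral_mono fun y => indicator_le_self _ _ _).trans (h r ⟨r.2, hr⟩)
        · have : ∀ y : S2, g ((r : ℝ) • (y : E)) = 0 := fun y => by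
            rw [hg, indicator_of_notMem]
            have hy : ‖(y : E)‖ = 1 := by simp
            rw [mem_ball_zero_iff, norm_smul, hy, mul_one, Real.norm_of_nonneg (le_of_lt r.2)]
            exact hr
          simp [this]
    _ = Q * ENNReal.ofReal (1 / 3) := by
        rw [lintegral_indicator measurableSet_Iio, setLIntegral_const,
          Measure.volumeIoiPow_apply_Iio]
        norm_num
    _ ≤ Q * 1 := by
        gcongr
        exact ENNReal.ofReal_le_one.2 (by norm_num)
    _ = Q := mul_one Q

theorem IsEigenfunction.continuousAt_homogExt {lam : ℝ} {φ : Fin 4 → E → ℝ}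
    (hφ : IsEigenfunction lam φ) {a : Fin 4} {x : E} (hx : x ∈ chart a) :
    ContinuousAt (homogExt lam φ a) x := by
  obtain ⟨G, hG⟩ := hφ.exists_hasGradLap hx
  exact hG.contDiffAt.continuousAt

theorem homogExt_of_mem (lam : ℝ) (φ : Fin 4 → E → ℝ) (a : Fin 4) {y : E} (hy : y ∈ S2) :
    homogExt lam φ a y = φ a y := by
  have h1 : ‖y‖ = 1 := by simpa using hy
  rw [homogExt, radialExt_of_mem _ hy, h1, Real.one_rpow, one_mul]

theorem IsEigenfunction.aestronglyMeasurable {lam : ℝ} {φ : Fin 4 → E → ℝ}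
    (hφ : IsEigenfunction lam φ) (a : Fin 4) :
    AEStronglyMeasurable (fun y : S2 => φ a y) sphereMeasure := by
  classical
  set s : Set S2 := {y | (y : E) ∈ chart a} with hs
  have hso : IsOpen s := (isOpen_chart a).preimage continuous_subtype_val
  have hc : ContinuousOn (fun y : S2 => φ a y) s := by
    have : ContinuousOn (fun y : S2 => homogExt lam φ a y) s := fun y hy =>
      (ContinuousAt.comp (f := fun y : S2 => (y : E)) (hφ.continuousAt_homogExt hy)
        continuous_subtype_val.continuousAt).continuousWithinAt
    exact this.congr fun y _ => (homogExt_of_mem lam φ a y.2).symm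
  have hm : Measurable (s.piecewise (fun y : S2 => φ a y) fun _ => 0) :=
    hc.measurable_piecewise continuousOn_const hso.measurableSet
  refine ⟨_, hm.stronglyMeasurable, ?_⟩
  filter_upwards [ae_mem_chart a] with y hy
  exact (piecewise_eq_of_mem s (fun z : S2 => φ a z) _ hy).symm

theorem IsEigenfunction.integrable_mul {lam mu : ℝ} {φ ψ : Fin 4 → E → ℝ}
    (hφ : IsEigenfunction lam φ) (hψ : IsEigenfunction mu ψ) :
    Integrable (fun y : S2 => φ 0 y * ψ 0 y) sphereMeasure := by
  obtain ⟨M, hM⟩ := hφ.bounded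
  obtain ⟨N, hN⟩ := hψ.bounded
  refine Integrable.of_bound ((hφ.aestronglyMeasurable 0).mul (hψ.aestronglyMeasurable 0))
    (M * N) ?_
  filter_upwards [ae_mem_chart 0] with y hy
  rw [norm_mul]
  exact mul_le_mul (hM 0 y ⟨y.2, hy⟩) (hN 0 y ⟨y.2, hy⟩) (norm_nonneg _)
    ((abs_nonneg _).trans (hM 0 y ⟨y.2, hy⟩))

end Polar

/-! ### Orthonormal systems of eigenfunctions -/

section Orthonormal

open MeasureTheory

variable {lam : ℕ → ℝ} {φ : ℕ → Fin 4 → E → ℝ}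

/-- The exponents of an orthonormal system of eigenfunctions are at least `61/40`. -/
theorem le_gammaPlus_of_orthonormal (hφ : ∀ l, IsEigenfunction (lam l) (φ l))
    (hon : ∀ k l, sphereInner (φ k) (φ l) = if k = l then 1 else 0) (l : ℕ) :
    61 / 40 ≤ gammaPlus (lam l) := by
  by_contra hlt
  have hzero : ∀ k, ∀ x ∈ chamber k, homogExt (lam l) (φ l) k x = 0 := fun k x hx => by
    by_contra hne; exact hlt ((hφ l).le_gammaPlus hx hne)
  have h1 := hon l l
  rw [if_pos rfl, sphereInner, integral_eq_zero_of_ae] at h1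
  · exact zero_ne_one h1
  · filter_upwards [ae_mem_chart 0] with y hy
    have hy0 : φ l 0 y = 0 := by
      rcases mem_chamber_or_openWall hy with ⟨k, hk⟩ | ⟨b, hb, hw⟩
      · have h2 := (hφ l).isSection.abs_eq y.2 hy (chamber_subset_chart k k hk)
        rw [← homogExt_of_mem (lam l) (φ l) k y.2, hzero k y hk, abs_zero] at h2
        exact abs_eq_zero.1 h2
      · exact (hφ l).equivariant.eq_zero (hφ l).isSection hb y.2 hw
    simp [hy0]

/-- The finite sum `∑ c_l r ^ γ_l φ_l` in the `a`-th frame. -/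
def partialSum (lam : ℕ → ℝ) (φ : ℕ → Fin 4 → E → ℝ) (s : Finset ℕ) (c : ℕ → ℝ) (a : Fin 4)
    (x : E) : ℝ :=
  ∑ l ∈ s, c l * homogExt (lam l) (φ l) a x

theorem integral_sq_sum (hφ : ∀ l, IsEigenfunction (lam l) (φ l))
    (hon : ∀ k l, sphereInner (φ k) (φ l) = if k = l then 1 else 0) (s : Finset ℕ) (d : ℕ → ℝ) :
    Integrable (fun y : S2 => (∑ l ∈ s, d l * φ l 0 y) ^ 2) sphereMeasure ∧
      ∫ y : S2, (∑ l ∈ s, d l * φ l 0 y) ^ 2 ∂sphereMeasure = ∑ l ∈ s, d l ^ 2 := by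
  have e : (fun y : S2 => (∑ l ∈ s, d l * φ l 0 y) ^ 2) =
      fun y : S2 => ∑ i ∈ s, ∑ j ∈ s, d i * d j * (φ i 0 y * φ j 0 y) := by
    ext y
    rw [sq, Finset.sum_mul_sum]
    exact Finset.sum_congr rfl fun i _ => Finset.sum_congr rfl fun j _ => by ring
  have hi : ∀ i j, Integrable (fun y : S2 => d i * d j * (φ i 0 y * φ j 0 y)) sphereMeasure :=
    fun i j => ((hφ i).integrable_mul (hφ j)).const_mul _
  rw [e]
  refine ⟨integrable_finsetSum _ fun i _ => integrable_finsetSum _ fun j _ => hi i j, ?_⟩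
  rw [integral_finsetSum _ fun i _ => integrable_finsetSum _ fun j _ => hi i j]
  refine Finset.sum_congr rfl fun i hi' => ?_
  rw [integral_finsetSum _ fun j _ => hi i j]
  have : ∀ j, ∫ y : S2, d i * d j * (φ i 0 y * φ j 0 y) ∂sphereMeasure =
      if i = j then d i * d j else 0 := fun j => by
    rw [integral_const_mul]
    change d i * d j * sphereInner (φ i) (φ j) = _
    rw [hon]; split_ifs <;> simp
  simp only [this, Finset.sum_ite_eq, hi', if_true]
  ring

theorem abs_partialSum_eq (hφ : ∀ l, IsEigenfunction (lam l) (φ l)) (s : Finset ℕ) (c : ℕ → ℝ)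
    {k : Fin 4} {x : E} (hx : x ∈ chamber k) :
    |partialSum lam φ s c k x| = |partialSum lam φ s c 0 x| := by
  by_cases hk : k = 0
  · rw [hk]
  have hx0 := ne_zero_of_mem_chamber hx
  have hy : ‖x‖⁻¹ • x ∈ S2 ∩ (chart k ∩ chart 0) :=
    ⟨inv_norm_smul_mem hx0, inv_norm_smul_mem_chart (chamber_subset_chart k k hx),
      inv_norm_smul_mem_chart (chamber_subset_chart k 0 hx)⟩
  have : partialSum lam φ s c 0 x =
      transition k 0 (‖x‖⁻¹ • x) * partialSum lam φ s c k x := by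
    rw [partialSum, partialSum, Finset.mul_sum]
    refine Finset.sum_congr rfl fun l _ => ?_
    rw [homogExt, homogExt, radialExt, radialExt, (hφ l).isSection k 0 hk _ hy]
    ring
  rw [this, abs_mul, abs_transition, one_mul]

/-- By orthonormality the `L²` norm of a finite sum over the unit ball is bounded by the `ℓ²` norm
of its coefficients. -/
theorem setIntegral_sq_partialSum_le (hφ : ∀ l, IsEigenfunction (lam l) (φ l))
    (hon : ∀ k l, sphereInner (φ k) (φ l) = if k = l then 1 else 0) (s : Finset ℕ) (c : ℕ → ℝ)
    (k : Fin 4) :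
    IntegrableOn (fun x => partialSum lam φ s c k x ^ 2) (Metric.ball 0 1 ∩ chamber k) ∧
      ∫ x in Metric.ball 0 1 ∩ chamber k, partialSum lam φ s c k x ^ 2 ≤ ∑ l ∈ s, c l ^ 2 := by
  classical
  have hcont : ∀ a, ContinuousOn (partialSum lam φ s c a) (chart a) := fun a =>
    continuousOn_finsetSum _ fun l _ => continuousOn_const.mul fun x hx =>
      ((hφ l).continuousAt_homogExt hx).continuousWithinAt
  set f : E → ENNReal := (chart 0).piecewise
    (fun x => ENNReal.ofReal (partialSum lam φ s c 0 x ^ 2)) (fun _ => 0) with hf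
  have hfm : Measurable f := by
    refine ContinuousOn.measurable_piecewise ?_ continuousOn_const (isOpen_chart 0).measurableSet
    exact ENNReal.continuous_ofReal.comp_continuousOn ((hcont 0).pow 2)
  have hsph : ∀ r ∈ Ioo (0 : ℝ) 1, ∫⁻ y : S2, f (r • (y : E)) ∂sphereMeasure ≤
      ENNReal.ofReal (∑ l ∈ s, c l ^ 2) := by
    intro r hr
    obtain ⟨hi, he⟩ := integral_sq_sum hφ hon s fun l => c l * r ^ gammaPlus (lam l)
    calc ∫⁻ y : S2, f (r • (y : E)) ∂sphereMeasure
        ≤ ∫⁻ y : S2, ENNReal.ofReal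
            ((∑ l ∈ s, c l * r ^ gammaPlus (lam l) * φ l 0 y) ^ 2) ∂sphereMeasure := by
          refine lintegral_mono fun y => ?_
          by_cases hy : r • (y : E) ∈ chart 0
          · rw [hf, piecewise_eq_of_mem _ _ _ hy]
            refine le_of_eq ?_
            congr 2
            refine Finset.sum_congr rfl fun l _ => ?_
            rw [homogExt_smul _ _ _ hr.1, homogExt_of_mem _ _ _ y.2, mul_assoc]
          · rw [hf, piecewise_eq_of_notMem _ _ _ hy]; exact zero_le
      _ = ENNReal.ofReal (∑ l ∈ s, (c l * r ^ gammaPlus (lam l)) ^ 2) := by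
          rw [← ofReal_integral_eq_lintegral_ofReal hi (Eventually.of_forall fun y => sq_nonneg _),
            he]
      _ ≤ _ := by
          refine ENNReal.ofReal_le_ofReal (Finset.sum_le_sum fun l _ => ?_)
          rw [mul_pow]
          refine mul_le_of_le_one_right (sq_nonneg _) (pow_le_one₀ (by have := hr.1; positivity) ?_)
          exact Real.rpow_le_one hr.1.le hr.2.le
            (by linarith [le_gammaPlus_of_orthonormal hφ hon l])
  have hl := lintegral_ball_le_of_sphere hfm _ hsph
  have hms : MeasurableSet (Metric.ball (0 : E) 1 ∩ chamber k) :=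
    Metric.isOpen_ball.measurableSet.inter (isOpen_chamber k).measurableSet
  have hle : ∫⁻ x in Metric.ball 0 1 ∩ chamber k, ENNReal.ofReal (partialSum lam φ s c k x ^ 2) ≤
      ENNReal.ofReal (∑ l ∈ s, c l ^ 2) := by
    refine le_trans ?_ hl
    calc _ = ∫⁻ x in Metric.ball 0 1 ∩ chamber k, f x := by
          refine setLIntegral_congr_fun hms fun x hx => ?_
          rw [hf, piecewise_eq_of_mem _ _ _ (chamber_subset_chart k 0 hx.2), ← sq_abs,
            abs_partialSum_eq hφ s c hx.2, sq_abs]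
      _ ≤ _ := lintegral_mono_set inter_subset_left
  have hmeas : AEStronglyMeasurable (fun x => partialSum lam φ s c k x ^ 2)
      (volume.restrict (Metric.ball 0 1 ∩ chamber k)) :=
    ContinuousOn.aestronglyMeasurable
      (((hcont k).mono fun x hx => chamber_subset_chart k k hx.2).pow 2) hms
  have hint : IntegrableOn (fun x => partialSum lam φ s c k x ^ 2)
      (Metric.ball 0 1 ∩ chamber k) := by
    refine ⟨hmeas, ?_⟩
    rw [hasFiniteIntegral_iff_ofReal (Eventually.of_forall fun x => sq_nonneg _)]
    exact hle.trans_lt ENNReal.ofReal_lt_top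
  refine ⟨hint, ?_⟩
  rw [integral_eq_lintegral_of_nonneg_ae (Eventually.of_forall fun x => sq_nonneg _) hmeas]
  exact ENNReal.toReal_le_of_le_ofReal (Finset.sum_nonneg fun l _ => sq_nonneg _) hle

/-- An eigenfunction with a nonnegative exponent tends to zero at the boundary of each chamber. -/
theorem IsEigenfunction.tendsto_homogExt {lam : ℝ} {φ : Fin 4 → E → ℝ}
    (hφ : IsEigenfunction lam φ) (hγ : 0 ≤ gammaPlus lam) {k : Fin 4} {p : E}
    (hp : p ∈ closure (chamber k)) (hpn : p ∉ chamber k) :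
    Tendsto (homogExt lam φ k) (𝓝[chamber k] p) (𝓝 0) := by
  rcases mem_openWall_or_ray (height_le_of_mem_closure_chamber hp) hpn with
    ⟨i, hi, hw⟩ | ⟨j, hj, hr⟩
  · rw [← hφ.homogExt_eq_zero hi hw]
    exact (hφ.continuousAt_homogExt (openWall_subset_chart hi.symm hw).1).tendsto.mono_left
      nhdsWithin_le_nhds
  · obtain ⟨a, b, h⟩ := exists_isOrder_two k j hj.symm
    obtain ⟨M, hM, hb⟩ := hφ.abs_homogExt_le
    have hk := fun y (hy : y ∈ chamber k) => chamber_subset_chart k k hy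
    have hκ : 0 ≤ gammaPlus lam * (gammaPlus lam + 1) - lam := sub_nonneg.2 (le_gammaPlus_mul lam)
    have key : ∀ σ : ℝ, |σ| = 1 → ∀ y ∈ chamber k, ‖y‖ ≤ 1 / 2 → σ * homogExt lam φ k y ≤
        6 * M / (1 - 1 / 2) ^ 2 * ‖luneCoord k a b y‖ ^ (3 / 2 : ℝ) := by
      intro σ hσ y hy hyn
      refine le_luneCoord_rpow h (V := fun y => σ * homogExt lam φ k y) hM (by norm_num) le_rfl
        (fun x hx => ?_) (fun x hx hpos => ?_) (fun i hi q hq ε hε => ?_) (fun x hx => ?_) hy hyn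
      · obtain ⟨G, hG⟩ := hφ.exists_hasGradLap (hk x hx.1)
        exact (hG.const_mul σ).contDiffAt
      · obtain ⟨G, hG⟩ := hφ.exists_hasGradLap (hk x hx.1)
        rw [(hG.const_mul σ).laplacian_eq, ← mul_div_assoc, mul_left_comm]
        positivity
      · have hc := (hφ.continuousAt_homogExt (openWall_subset_chart hi.symm hq.1).1).const_mul σ
        refine nhdsWithin_le_nhds (hc.eventually_lt continuousAt_const ?_)
        simpa [hφ.homogExt_eq_zero hi hq.1] using hε
      · refine (le_abs_self _).trans ?_
        rw [abs_mul, hσ, one_mul]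
        refine (hb k x (hk x hx.1)).trans (mul_le_of_le_one_right hM ?_)
        exact Real.rpow_le_one (norm_nonneg _) (mem_ball_zero_iff.1 hx.2).le hγ
    -- Homogeneity moves the estimate near the origin to a neighbourhood of `p`.
    set t : ℝ := (4 * (‖p‖ + 1))⁻¹ with ht
    have ht0 : 0 < t := by positivity
    set C := 6 * M / (1 - 1 / 2) ^ 2 with hC
    have hbound : ∀ᶠ x in 𝓝[chamber k] p, |homogExt lam φ k x| ≤
        (t ^ gammaPlus lam)⁻¹ * (C * ‖luneCoord k a b (t • x)‖ ^ (3 / 2 : ℝ)) := by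
      have hnear : ∀ᶠ x in 𝓝[chamber k] p, ‖x‖ < ‖p‖ + 1 :=
        nhdsWithin_le_nhds (continuousAt_id.norm.eventually_lt continuousAt_const (lt_add_one _))
      filter_upwards [hnear, self_mem_nhdsWithin] with x hx hxc
      have htx : ‖t • x‖ ≤ 1 / 2 := by
        rw [norm_smul, Real.norm_of_nonneg ht0.le, ht, inv_mul_le_iff₀ (by positivity)]
        linarith [norm_nonneg p]
      have htc := (smul_mem_chamber ht0).2 hxc
      have h1 := key 1 (by norm_num) _ htc htx
      have h2 := key (-1) (by norm_num) _ htc htx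
      have h3 : |homogExt lam φ k (t • x)| ≤ C * ‖luneCoord k a b (t • x)‖ ^ (3 / 2 : ℝ) :=
        abs_le.2 ⟨by linarith, by linarith⟩
      rw [homogExt_smul _ _ _ ht0, abs_mul, abs_of_nonneg (by positivity)] at h3
      rw [← div_eq_inv_mul, le_div_iff₀ (by positivity), mul_comm]
      exact h3
    refine squeeze_zero_norm' hbound ?_
    have hc : Continuous fun x : E =>
        (t ^ gammaPlus lam)⁻¹ * (C * ‖luneCoord k a b (t • x)‖ ^ (3 / 2 : ℝ)) :=
      continuous_const.mul (continuous_const.mul (Continuous.rpow_const (by fun_prop)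
        fun x => Or.inr (by norm_num)))
    have h0 := (hc.tendsto p).mono_left (nhdsWithin_le_nhds (s := chamber k))
    simpa [luneCoord_ray h hr, map_smul] using h0

/-- Finite sums of the homogeneous extensions are bounded on smaller balls by the `ℓ²` norm of the
coefficients, uniformly in the number of terms. -/
theorem exists_sq_partialSum_le (hφ : ∀ l, IsEigenfunction (lam l) (φ l))
    (hon : ∀ k l, sphereInner (φ k) (φ l) = if k = l then 1 else 0) {r₁ : ℝ} (hr₁ : r₁ < 1) :
    ∃ C, 0 ≤ C ∧ ∀ (s : Finset ℕ) (c : ℕ → ℝ) (k : Fin 4), ∀ x ∈ chamber k, ‖x‖ ≤ r₁ →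
      partialSum lam φ s c k x ^ 2 ≤ C * ∑ l ∈ s, c l ^ 2 := by
  have hI : 0 < ∫ z : E, ballWeight z := integral_ballWeight_pos
  set R := 1 - r₁ with hR
  have hR0 : 0 < R := sub_pos.2 hr₁
  refine ⟨8 * (R ^ 3)⁻¹ / ∫ z : E, ballWeight z, by positivity, ?_⟩
  intro s c k x hx hxr
  have hk := fun y (hy : y ∈ chamber k) => chamber_subset_chart k k hy
  have hγ := le_gammaPlus_of_orthonormal hφ hon
  have pos_case : ∀ c : ℕ → ℝ, 0 < partialSum lam φ s c k x → partialSum lam φ s c k x ^ 2 ≤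
      8 * (R ^ 3)⁻¹ / (∫ z : E, ballWeight z) * ∑ l ∈ s, c l ^ 2 := by
    intro c hpos
    obtain ⟨hint, hle⟩ := setIntegral_sq_partialSum_le hφ hon s c k
    have hsub : Metric.ball x R ∩ chamber k ⊆ Metric.ball 0 1 ∩ chamber k := by
      refine inter_subset_inter_left _ fun y hy => ?_
      rw [mem_ball_iff_norm] at hy
      rw [mem_ball_zero_iff]
      have := norm_add_le (y - x) x
      rw [sub_add_cancel] at this
      linarith
    have hmain := sq_mul_le_setIntegral_sq (k := k) (v := partialSum lam φ s c k) (fun y hy => by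
        choose G hG using fun l => (hφ l).exists_hasGradLap (hk y hy)
        refine ⟨_, (HasGradLap.sum s fun l _ => (hG l).const_mul (c l)).congr_val rfl ?_⟩
        refine Finset.sum_eq_zero fun l _ => ?_
        have hl : -(1 / 4) ≤ lam l := by
          by_contra hlt
          have h0 : gammaPlus (lam l) = -(1 / 2) := by
            rw [gammaPlus, Real.sqrt_eq_zero_of_nonpos (by linarith), add_zero]
          linarith [hγ l]
        rw [gammaPlus_mul hl, sub_self, zero_mul, zero_div, mul_zero])
      (fun p hp hpn => by
        have := tendsto_finsetSum s fun l _ =>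
          ((hφ l).tendsto_homogExt (by linarith [hγ l]) hp hpn).const_mul (c l)
        simp only [mul_zero, Finset.sum_const_zero] at this
        exact this) hx hpos hR0 (hint.mono_set hsub)
    have hmono : ∫ y in Metric.ball x R ∩ chamber k, partialSum lam φ s c k y ^ 2 ≤
        ∑ l ∈ s, c l ^ 2 :=
      (setIntegral_mono_set hint (Eventually.of_forall fun y => sq_nonneg _)
        hsub.eventuallyLE).trans hle
    rw [div_mul_eq_mul_div, le_div_iff₀ hI]
    exact hmain.trans (mul_le_mul_of_nonneg_left hmono (by positivity))
  have hneg : partialSum lam φ s (fun l => -c l) k x = -partialSum lam φ s c k x := by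
    simp [partialSum]
  rcases lt_trichotomy (partialSum lam φ s c k x) 0 with h | h | h
  · have := pos_case (fun l => -c l) (by rw [hneg]; linarith)
    simpa [hneg] using this
  · rw [h]
    have : 0 ≤ ∑ l ∈ s, c l ^ 2 := Finset.sum_nonneg fun l _ => sq_nonneg _
    rw [zero_pow two_ne_zero]
    exact mul_nonneg (by positivity) this
  · exact pos_case c h

end Orthonormal

/-! ### Decay of the Poisson extension -/

section Decay

/-- Inside a chamber, the distance to the branching set is at least the distance to the line
through one of the three vertices of that chamber. -/
theorem exists_norm_luneCoord_le_infDist {k : Fin 4} {x : E} (hx : x ∈ chamber k) :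
    ∃ j a b, IsOrder k j a b ∧ ‖luneCoord k a b x‖ ≤ Metric.infDist x branchSet := by
  obtain ⟨j, hj, hmax⟩ := Finset.exists_max_image (Finset.univ.erase k)
    (fun i => height i x ^ 2) (by
      obtain ⟨a, b, c, h⟩ := exists_isOrder k
      exact ⟨a, by simpa using h.1.symm⟩)
  obtain ⟨a, b, h⟩ := exists_isOrder_two k j (Finset.ne_of_mem_erase hj).symm
  refine ⟨j, a, b, h, ?_⟩
  have hne : branchSet.Nonempty := ⟨0, mem_iUnion.2 ⟨0, 0, le_rfl, by simp⟩⟩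
  refine (Metric.le_infDist hne).2 fun {y} hy => ?_
  rw [dist_eq_norm]
  obtain ⟨i, hi⟩ := mem_iUnion.1 hy
  by_cases hik : i = k
  · -- The height of `x` over `p_k` is negative, so the nearest point of that ray is the origin.
    subst hik
    refine (norm_luneCoord_le h x).trans ?_
    obtain ⟨t, ht, rfl⟩ := hi
    have hh : height i x ≤ 0 := by
      obtain ⟨h1, h2, h3⟩ := h.mem_chamber_iff.1 hx
      linarith [h.height_sum x]
    have hsq := norm_sub_sq_real x (t • vertex i)
    rw [real_inner_smul_right, real_inner_comm] at hsq
    change _ = _ - 2 * (t * height i x) + _ at hsq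
    refine le_of_sq_le_sq ?_ (norm_nonneg _)
    nlinarith [mul_nonneg ht (neg_nonneg.2 hh), sq_nonneg ‖t • vertex i‖]
  · obtain ⟨a', b', h'⟩ := exists_isOrder_two k i (Ne.symm hik)
    calc ‖luneCoord k a b x‖ ≤ ‖luneCoord k a' b' x‖ := by
          refine le_of_sq_le_sq ?_ (norm_nonneg _)
          rw [norm_sq_luneCoord h, norm_sq_luneCoord h']
          linarith [hmax i (Finset.mem_erase.2 ⟨hik, Finset.mem_univ i⟩)]
      _ = ‖luneCoord k a' b' (x - y)‖ := by rw [map_sub, luneCoord_ray h' hi, sub_zero]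
      _ ≤ ‖x - y‖ := norm_luneCoord_le h' _

/-- A bound for a section inside the chambers holds at all points off the branching set, since an
equivariant section vanishes on the walls. -/
theorem abs_le_of_forall_chamber {U : Set E} {u : Fin 4 → E → ℝ} (hs : IsSection U u)
    (he : IsEquivariant U u) {a : Fin 4} {x : E} (hx : x ∈ U) (ha : x ∈ chart a) {B : ℝ}
    (hB : 0 ≤ B) (h : ∀ k, x ∈ chamber k → |u k x| ≤ B) : |u a x| ≤ B := by
  rcases mem_chamber_or_openWall ha with ⟨k, hk⟩ | ⟨b, hb, hw⟩
  · rw [hs.abs_eq hx ha (chamber_subset_chart k k hk)]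
    exact h k hk
  · rw [he.eq_zero hs hb hx hw, abs_zero]
    exact hB

/-- The pointwise limit of partial sums whose squares are bounded by the `ℓ²` norm of the
coefficients. -/
theorem sq_le_of_hasSum {f d : ℕ → ℝ} {v C Q : ℝ} (hC : 0 ≤ C) (hv : HasSum f v)
    (hf : ∀ s : Finset ℕ, (∑ l ∈ s, f l) ^ 2 ≤ C * ∑ l ∈ s, d l ^ 2)
    (hd : ∀ s : Finset ℕ, ∑ l ∈ s, d l ^ 2 ≤ Q) : v ^ 2 ≤ C * Q :=
  le_of_tendsto (hv.pow 2) (Eventually.of_forall fun s =>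
    (hf s).trans (mul_le_mul_of_nonneg_left (hd s) hC))

variable {u : Fin 4 → E → ℝ} {lam : ℕ → ℝ} {φ : ℕ → Fin 4 → E → ℝ} {coeff : ℕ → ℝ}

theorem hasSum_homogExt (hu : ∀ a, ∀ y ∈ S2 ∩ chart a, ∀ r ∈ Ioo (0 : ℝ) 1,
      HasSum (fun l => coeff l * r ^ gammaPlus (lam l) * φ l a y) (u a (r • y)))
    {a : Fin 4} {x : E} (hx : x ∈ chart a) (hx1 : ‖x‖ < 1) :
    HasSum (fun l => coeff l * homogExt (lam l) (φ l) a x) (u a x) := by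
  have hx0 := ne_zero_of_mem_chart hx
  have h := hu a (‖x‖⁻¹ • x) ⟨inv_norm_smul_mem hx0, inv_norm_smul_mem_chart hx⟩ ‖x‖
    ⟨norm_pos_iff.2 hx0, hx1⟩
  rw [smul_inv_smul₀ (norm_ne_zero_iff.2 hx0)] at h
  simpa only [homogExt, radialExt, mul_assoc] using h

/-- The sum of the series is bounded on smaller balls, and it decays at the origin at the rate given
by the smallest possible exponent `61/40`. -/
theorem exists_abs_le_rpow (hφ : ∀ l, IsEigenfunction (lam l) (φ l))
    (hon : ∀ k l, sphereInner (φ k) (φ l) = if k = l then 1 else 0)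
    (hsum : Summable fun l => coeff l ^ 2)
    (hu : ∀ a, ∀ y ∈ S2 ∩ chart a, ∀ r ∈ Ioo (0 : ℝ) 1,
      HasSum (fun l => coeff l * r ^ gammaPlus (lam l) * φ l a y) (u a (r • y)))
    {r₁ : ℝ} (h0 : 0 < r₁) (h1 : r₁ < 1) :
    ∃ M, 0 ≤ M ∧ ∀ k, ∀ x ∈ chamber k, ‖x‖ ≤ r₁ → |u k x| ≤ M * (‖x‖ / r₁) ^ (61 / 40 : ℝ) := by
  obtain ⟨C, hC, hbd⟩ := exists_sq_partialSum_le hφ hon h1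
  set Q := ∑' l, coeff l ^ 2 with hQ
  have hQ0 : 0 ≤ Q := tsum_nonneg fun l => sq_nonneg _
  refine ⟨√(C * Q), Real.sqrt_nonneg _, fun k x hx hxr => ?_⟩
  have hxpos : 0 < ‖x‖ := norm_pos_iff.2 (ne_zero_of_mem_chamber hx)
  -- Rescale `x` to the sphere of radius `r₁`, absorbing the factors into the coefficients.
  set ρ := ‖x‖ / r₁ with hρ
  have hρ0 : 0 < ρ := by positivity
  have hρ1 : ρ ≤ 1 := (div_le_one h0).2 hxr
  have hx' : ρ⁻¹ • x ∈ chamber k := (smul_mem_chamber (inv_pos.2 hρ0)).2 hx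
  have hn : ‖ρ⁻¹ • x‖ ≤ r₁ := by
    rw [norm_smul, Real.norm_of_nonneg (inv_nonneg.2 hρ0.le), hρ, inv_div]
    exact le_of_eq (by field_simp)
  have hsq : u k x ^ 2 ≤ C * ((ρ ^ (61 / 40 : ℝ)) ^ 2 * Q) := by
    refine sq_le_of_hasSum (d := fun l => coeff l * ρ ^ gammaPlus (lam l)) hC
      (hasSum_homogExt hu (chamber_subset_chart k k hx) (hxr.trans_lt h1)) (fun s => ?_)
      (fun s => ?_)
    · refine le_trans (le_of_eq ?_) (hbd s (fun l => coeff l * ρ ^ gammaPlus (lam l)) k _ hx' hn)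
      rw [partialSum]
      congr 1
      refine Finset.sum_congr rfl fun l _ => ?_
      rw [mul_assoc, ← homogExt_smul _ _ _ hρ0, smul_inv_smul₀ hρ0.ne']
    · calc ∑ l ∈ s, (coeff l * ρ ^ gammaPlus (lam l)) ^ 2
          ≤ ∑ l ∈ s, (ρ ^ (61 / 40 : ℝ)) ^ 2 * coeff l ^ 2 := by
            refine Finset.sum_le_sum fun l _ => ?_
            rw [mul_pow, mul_comm]
            have := Real.rpow_le_rpow_of_exponent_ge hρ0 hρ1 (le_gammaPlus_of_orthonormal hφ hon l)
            gcongr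
        _ ≤ _ := by
            rw [← Finset.mul_sum]
            exact mul_le_mul_of_nonneg_left (hsum.sum_le_tsum s fun l _ => sq_nonneg _)
              (sq_nonneg _)
  calc |u k x| = √(u k x ^ 2) := (Real.sqrt_sq_eq_abs _).symm
    _ ≤ √(C * Q * (ρ ^ (61 / 40 : ℝ)) ^ 2) := Real.sqrt_le_sqrt (hsq.trans (le_of_eq (by ring)))
    _ = √(C * Q) * ρ ^ (61 / 40 : ℝ) := by
        rw [Real.sqrt_mul (by positivity), Real.sqrt_sq (by positivity)]

/-- A bounded equivariant harmonic section decays at the rate `3/2` along the branching set. -/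
theorem abs_le_infDist_rpow (hharm : IsZ2Harmonic u) (hequi : IsEquivariant B3 u) {M r₀ r₁ : ℝ}
    (hM : 0 ≤ M) (hr : r₀ < r₁) (hr₁ : r₁ ≤ 1)
    (hb : ∀ k, ∀ x ∈ chamber k ∩ Metric.ball 0 r₁, |u k x| ≤ M) {k : Fin 4} {x : E}
    (hx : x ∈ chamber k) (hxr : ‖x‖ ≤ r₀) :
    |u k x| ≤ 6 * M / (r₁ - r₀) ^ 2 * Metric.infDist x branchSet ^ (3 / 2 : ℝ) := by
  obtain ⟨j, a, b, h, hle⟩ := exists_norm_luneCoord_le_infDist hx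
  have hsub : Metric.ball (0 : E) r₁ ⊆ B3 := Metric.ball_subset_ball hr₁
  have key : ∀ σ : ℝ, |σ| = 1 →
      σ * u k x ≤ 6 * M / (r₁ - r₀) ^ 2 * ‖luneCoord k a b x‖ ^ (3 / 2 : ℝ) := by
    intro σ hσ
    have hσu : ∀ y ∈ B3 ∩ chart k, HarmonicAt (fun y => σ * u k y) y := fun y hy =>
      (hharm.2 k y hy).const_smul (c := σ)
    refine le_luneCoord_rpow h (V := fun y => σ * u k y) hM hr hr₁ (fun y hy => ?_)
      (fun y hy _ => ?_) (fun i hi p hp ε hε => ?_) (fun y hy => ?_) hx hxr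
    · exact (hσu y ⟨hsub hy.2, chamber_subset_chart k k hy.1⟩).1
    · exact (hσu y ⟨hsub hy.2, chamber_subset_chart k k hy.1⟩).2.self_of_nhds.ge
    · have hp' := (openWall_subset_chart hi.symm hp.1).1
      refine nhdsWithin_le_nhds
        ((hσu p ⟨hsub hp.2, hp'⟩).1.continuousAt.eventually_lt continuousAt_const ?_)
      simpa [hequi.eq_zero hharm.1 hi.symm (hsub hp.2) hp.1] using hε
    · refine (le_abs_self _).trans ?_
      rw [abs_mul, hσ, one_mul]
      exact hb k y hy
  have h1 := key 1 (by norm_num)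
  have h2 := key (-1) (by norm_num)
  calc |u k x| ≤ 6 * M / (r₁ - r₀) ^ 2 * ‖luneCoord k a b x‖ ^ (3 / 2 : ℝ) :=
        abs_le.2 ⟨by linarith, by linarith⟩
    _ ≤ _ := by gcongr

end Decay

end TetraZ2

end

theorem proposition2 (u : Fin 4 → TetraZ2.E → ℝ)
    (hharm : TetraZ2.IsZ2Harmonic u)
    (hequi : TetraZ2.IsEquivariant TetraZ2.B3 u)
    (hu : TetraZ2.IsPoissonExtension u) :
    (∀ r₀ : ℝ, 0 < r₀ → r₀ < 1 → ∃ C : ℝ, ∀ a, ∀ x ∈ TetraZ2.chart a, ‖x‖ ≤ r₀ →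
      |u a x| ≤ C * Metric.infDist x TetraZ2.branchSet ^ (3 / 2 : ℝ)) ∧
    (∃ ε : ℝ, 0 < ε ∧ ∃ C : ℝ, ∃ δ : ℝ, 0 < δ ∧ ∀ a, ∀ x ∈ TetraZ2.chart a, ‖x‖ < δ →
      |u a x| ≤ C * ‖x‖ ^ (3 / 2 + ε : ℝ)) := by
  obtain ⟨lam, φ, coeff, hφ, hon, hsum, hu⟩ := hu
  constructor
  · intro r₀ hr0 hr1
    obtain ⟨M, hM, hb⟩ := TetraZ2.exists_abs_le_rpow hφ hon hsum hu
      (r₁ := (1 + r₀) / 2) (by linarith) (by linarith)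
    refine ⟨6 * M / ((1 + r₀) / 2 - r₀) ^ 2, fun a x hx hxr => ?_⟩
    have hd : 0 ≤ Metric.infDist x TetraZ2.branchSet := Metric.infDist_nonneg
    refine TetraZ2.abs_le_of_forall_chamber hharm.1 hequi
      (mem_ball_zero_iff.2 (hxr.trans_lt hr1)) hx (by positivity) fun k hk => ?_
    refine TetraZ2.abs_le_infDist_rpow hharm hequi hM (by linarith) (by linarith)
      (fun j y hy => ?_) hk hxr
    have hy2 := (mem_ball_zero_iff.1 hy.2).le
    refine (hb j y hy.1 hy2).trans (mul_le_of_le_one_right hM ?_)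
    exact Real.rpow_le_one (by positivity) ((div_le_one (by linarith)).2 hy2) (by norm_num)
  · obtain ⟨M, hM, hb⟩ := TetraZ2.exists_abs_le_rpow hφ hon hsum hu
      (r₁ := 1 / 2) (by norm_num) (by norm_num)
    refine ⟨1 / 40, by norm_num, M * ((1 / 2 : ℝ) ^ (61 / 40 : ℝ))⁻¹, 1 / 2, by norm_num,
      fun a x hx hxr => ?_⟩
    refine TetraZ2.abs_le_of_forall_chamber hharm.1 hequi
      (mem_ball_zero_iff.2 (by linarith)) hx (by positivity) fun k hk => ?_
    refine (hb k x hk hxr.le).trans (le_of_eq ?_)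
    rw [Real.div_rpow (norm_nonneg _) (by norm_num), div_eq_mul_inv, mul_assoc, mul_comm (‖x‖ ^ _)]
    norm_num
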